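/- Let $q$ be a prime power, let $n,k,M$ be positive integers with $k\le n$, and let $V$ be an $n$-dimensional vector space over the field $\mathbb F_q$ with $q$ elements. Write $\binom{a}{b}_q=\prod_{i=0}^{b-1}\frac{q^{a-i}-1}{q^{b-i}-1}$ for the Gaussian binomial coefficient. For a family $\mathcal F$ of $k$-dimensional subspaces of $V$ put $$\mathcal I(\mathcal F)=\sum_{A\in\mathcal F}\sum_{B\in\mathcal F}\dim(A\cap B),\qquad \mathcal{MI}(\mathcal F)=\max_{|\mathcal G|=|\mathcal F|}\mathcal I(\mathcal G),$$ where the maximum is over all families $\mathcal G$ of $k$-dimensional subspaces of $V$ with $|\mathcal G|=|\mathcal F|$. If $|\mathcal F|=M$, then $$\mathcal{MI}(\mathcal F)\le\left(\frac{\binom{n}{k}_q}{M}-\binom{n}{1}_q\right)\frac{q\,M^2\binom{k}{1}_q\binom{n-k}{1}_q}{\binom{n}{1}_q\left(\binom{n}{1}_q-1\right)}+kM^2 .$$ If moreover $n\ge 2k$ and $M\le\binom{n-1}{k-1}_q$, then $$\mathcal{MI}(\mathcal F)\le\left[\frac{\binom{n}{k}_q}{M}-\frac{(q^n-1)(q^{n-1}-1)}{(q-1)(q^k-1)}\right]\frac{M^2(q^k-1)(q^{k-1}-1)(q^{n-k}-1)}{(q^n-1)(q^{n-1}-1)(q^{n-2}-1)}+kM^2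 .$$ In the two degenerate cases where the second fraction of a bound has the form $0/0$ (the first bound for $n=k=1$, the second for $n=2$, $k=1$), that fraction is read as $0$. -/

import Mathlib

/-- The Gaussian binomial coefficient `[n choose k]_q`, that is
`∏_{i < k} (q^(n-i) - 1) / (q^(k-i) - 1)`, as a real number. It is used for `q ≥ 2`, so no
denominator vanishes; for `k > n` the factor `i = n` makes it `0`. -/
noncomputable def gaussBinom (q n k : ℕ) : ℝ :=
  ∏ i ∈ Finset.range k, ((q : ℝ) ^ (n - i) - 1) / ((q : ℝ) ^ (k - i) - 1)

/-- The set of all `k`-dimensional subspaces of `V`. -/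
abbrev Grass (K V : Type*) [Field K] [AddCommGroup V] [Module K V] (k : ℕ) : Type _ :=
  {U : Submodule K V // Module.finrank K U = k}

/-- The total intersection number: the sum of `dim (A ∩ B)` over all ordered pairs `(A, B)` of
members of the family, including the pairs with `A = B`. -/
noncomputable def totalInt {K V : Type*} [Field K] [AddCommGroup V] [Module K V] {k : ℕ}
    (F : Finset (Grass K V k)) : ℕ :=
  ∑ A ∈ F, ∑ B ∈ F, Module.finrank K (A.1 ⊓ B.1 : Submodule K V)

/-- The maximal total intersection number among all families of `k`-dimensional subspaces
with the same size as the given one. -/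
noncomputable def maxTotalInt {K V : Type*} [Field K] [AddCommGroup V] [Module K V] {k : ℕ}
    (F : Finset (Grass K V k)) : ℕ :=
  sSup {m : ℕ | ∃ G : Finset (Grass K V k), G.card = F.card ∧ totalInt G = m}

/-- Over a finite field and in finite dimension the supremum above is an attained maximum. -/
theorem isGreatest_maxTotalInt {K V : Type*} [Field K] [Finite K] [AddCommGroup V] [Module K V]
    [FiniteDimensional K V] {k : ℕ} (F : Finset (Grass K V k)) :
    IsGreatest {m : ℕ | ∃ G : Finset (Grass K V k), G.card = F.card ∧ totalInt G = m}
      (maxTotalInt F) := by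
  have hV : Finite V := Module.finite_of_finite K
  have hS : Finite (Submodule K V) :=
    Finite.of_injective (fun U : Submodule K V => (U : Set V)) SetLike.coe_injective
  have hfin : {m : ℕ | ∃ G : Finset (Grass K V k), G.card = F.card ∧ totalInt G = m}.Finite := by
    refine (Set.finite_range (totalInt (K := K) (V := V) (k := k))).subset ?_
    rintro m ⟨G, -, rfl⟩
    exact ⟨G, rfl⟩
  exact ⟨Nat.sSup_mem ⟨_, F, rfl, rfl⟩ hfin.bddAbove, fun m hm => le_csSup hfin.bddAbove hm⟩

open Module

/-! The maximum is attained, so it suffices to bound the total intersection number of one family F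
of size M. The argument is a linear programming bound of Delsarte type in elementary form. Write
[d]_j for the Gaussian binomial coefficient.

Minorize k - d, for d < k, by g(d) = a + b[d]_1 - c[d]_2 and sum over all pairs with d = dim(A ∩ B).
Since [dim(A ∩ B)]_j counts the j-spaces inside both A and B, its sum over pairs is the sum of
squared degrees `degSq F j`; the pairs A = B cost an extra g(k) each. This is
`totalInt_le_of_minorant`, and it leaves upper bounds for degree squares to be found.

Those come from a single sum of squares, `sum_sq_degBelow_nonneg`: the squared norm of f = a·1_F +
b·D₁ + c·D₂ + d is nonnegative, where D_j(A) is the total degree of the j-spaces in A. The useful f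
is a multiple of the projection of 1_F that kills the first eigenspaces of the Grassmann scheme.
Then ‖f‖² is a positive multiple of ⟨1_F, f⟩, an expression linear in the degree squares. Spectral
theory only guides the choice of coefficients; the proof checks polynomial identities.

The first bound uses points only: ([k]_1 - [d]_1)/q^(k-1) ≤ k - d, with `points_degSq_le`. The
second uses points and lines (`lines_degSq_le`) with a minorant equal to 1 at d = k - 1 and at most
2 below (`minorant_le`). Its diagonal terms balance exactly for k = 3 (`diagonal_le_of_three`) and
have room to spare for k ≥ 4 (`diagonal_le_of_large`); k = 1 and k = 2 need only constant minorants.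
-/

open scoped Classical in
/-- The indicator of the inclusion `U ≤ W`. -/
noncomputable def inc {K V : Type*} [Field K] [AddCommGroup V] [Module K V]
    (U W : Submodule K V) : ℝ := if U ≤ W then 1 else 0

/-! ### Counting subspaces by Gaussian binomials -/

section Counting

variable {K V : Type*} [Field K] [AddCommGroup V] [Module K V]

theorem inc_of_le {U W : Submodule K V} (h : U ≤ W) : inc U W = 1 := if_pos h

theorem inc_of_not_le {U W : Submodule K V} (h : ¬ U ≤ W) : inc U W = 0 := if_neg h

theorem inc_mul_inc_right (U U' W : Submodule K V) : inc U W * inc U' W = inc (U ⊔ U') W := by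
  unfold inc
  by_cases h : U ≤ W <;> by_cases h' : U' ≤ W <;> simp [h, h']

theorem inc_mul_inc_left (U W W' : Submodule K V) : inc U W * inc U W' = inc U (W ⊓ W') := by
  unfold inc
  by_cases h : U ≤ W <;> by_cases h' : U ≤ W' <;> simp [h, h']

variable [Finite K] [FiniteDimensional K V]

theorem finite_submodule : Finite (Submodule K V) :=
  have : Finite V := Module.finite_of_finite K
  Finite.of_injective (fun U : Submodule K V => (U : Set V)) SetLike.coe_injective

noncomputable instance Grass.instFintype (k : ℕ) : Fintype (Grass K V k) :=
  have : Finite (Submodule K V) := finite_submodule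
  Fintype.ofFinite _

theorem sum_inc_eq_card {k : ℕ} (p : Grass K V k → Prop) [DecidablePred p] :
    ∑ A : Grass K V k, (if p A then (1 : ℝ) else 0) = Nat.card {A : Grass K V k // p A} := by
  rw [Finset.sum_boole, Nat.card_eq_fintype_card, Fintype.card_subtype]

/-- Subspaces of dimension `k` above `U` are subspaces of the quotient by `U`. -/
noncomputable def grassAboveEquiv (U : Submodule K V) (k : ℕ) (h : finrank K U ≤ k) :
    {A : Grass K V k // U ≤ A.1} ≃ Grass K (V ⧸ U) (k - finrank K U) where
  toFun A := ⟨A.1.1.map U.mkQ, by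
    have h1 := LinearMap.finrank_range_add_finrank_ker (U.mkQ.domRestrict A.1.1)
    have h2 : (U.mkQ.domRestrict A.1.1).range = A.1.1.map U.mkQ := by
      rw [LinearMap.range_domRestrict]
    have h3 : (U.mkQ.domRestrict A.1.1).ker = U.comap A.1.1.subtype := by
      rw [LinearMap.ker_domRestrict, Submodule.ker_mkQ]
    have h4 : finrank K (U.comap A.1.1.subtype) = finrank K U :=
      (Submodule.comapSubtypeEquivOfLe A.2).finrank_eq
    rw [h2, h3, h4, A.1.2] at h1
    omega⟩
  invFun B := ⟨⟨B.1.comap U.mkQ, by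
    have h0 : U ≤ B.1.comap U.mkQ := by
      intro v hv
      simp [(Submodule.Quotient.mk_eq_zero U).2 hv]
    have h1 := LinearMap.finrank_range_add_finrank_ker (U.mkQ.domRestrict (B.1.comap U.mkQ))
    have h2 : (U.mkQ.domRestrict (B.1.comap U.mkQ)).range = B.1 := by
      rw [LinearMap.range_domRestrict, Submodule.map_comap_eq, Submodule.range_mkQ, top_inf_eq]
    have h3 : (U.mkQ.domRestrict (B.1.comap U.mkQ)).ker =
        U.comap (B.1.comap U.mkQ).subtype := by
      rw [LinearMap.ker_domRestrict, Submodule.ker_mkQ]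
    have h4 : finrank K (U.comap (B.1.comap U.mkQ).subtype) = finrank K U :=
      (Submodule.comapSubtypeEquivOfLe h0).finrank_eq
    rw [h2, h3, h4, B.2] at h1
    omega⟩, by
      intro v hv
      simp [(Submodule.Quotient.mk_eq_zero U).2 hv]⟩
  left_inv A := by
    apply Subtype.ext
    apply Subtype.ext
    simp only [Submodule.comap_map_mkQ]
    exact sup_eq_right.2 A.2
  right_inv B := by
    apply Subtype.ext
    simp only [Submodule.map_comap_eq, Submodule.range_mkQ, top_inf_eq]

/-- Subspaces of dimension `k` inside `W`. -/
noncomputable def grassBelowEquiv (W : Submodule K V) (k : ℕ) :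
    {A : Grass K V k // A.1 ≤ W} ≃ Grass K W k where
  toFun A := ⟨A.1.1.comap W.subtype, by
    rw [(Submodule.comapSubtypeEquivOfLe A.2).finrank_eq]
    exact A.1.2⟩
  invFun B := ⟨⟨B.1.map W.subtype, by
    rw [Submodule.finrank_map_subtype_eq]
    exact B.2⟩, Submodule.map_subtype_le _ _⟩
  left_inv A := by
    apply Subtype.ext
    apply Subtype.ext
    simp only [Submodule.map_comap_subtype]
    exact inf_eq_right.2 A.2
  right_inv B := by
    apply Subtype.ext
    simp only [Submodule.comap_map_eq_of_injective W.injective_subtype]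

theorem gaussBinom_zero_right (q n : ℕ) : gaussBinom q n 0 = 1 := by
  simp [gaussBinom]

theorem gaussBinom_one_right (q n : ℕ) :
    gaussBinom q n 1 = ((q : ℝ) ^ n - 1) / ((q : ℝ) - 1) := by
  simp [gaussBinom]

theorem gaussBinom_succ_succ (q n k : ℕ) :
    gaussBinom q (n + 1) (k + 1) =
      ((q : ℝ) ^ (n + 1) - 1) / ((q : ℝ) ^ (k + 1) - 1) * gaussBinom q n k := by
  unfold gaussBinom
  rw [Finset.prod_range_succ', mul_comm]
  simp

theorem gaussBinom_eq_zero {q n k : ℕ} (h : n < k) : gaussBinom q n k = 0 := by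
  unfold gaussBinom
  exact Finset.prod_eq_zero (Finset.mem_range.2 h) (by simp)

theorem sum_inc_above (U : Submodule K V) {k : ℕ} (h : finrank K U ≤ k) :
    ∑ A : Grass K V k, inc U A.1 = Nat.card (Grass K (V ⧸ U) (k - finrank K U)) := by
  classical
  rw [← Nat.card_congr (grassAboveEquiv U k h), ← sum_inc_eq_card]
  rfl

theorem sum_inc_below (W : Submodule K V) (k : ℕ) :
    ∑ A : Grass K V k, inc A.1 W = Nat.card (Grass K W k) := by
  classical
  rw [← Nat.card_congr (grassBelowEquiv W k), ← sum_inc_eq_card]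
  rfl

theorem card_grass_one :
    (Nat.card (Grass K V 1) : ℝ) = gaussBinom (Nat.card K) (finrank K V) 1 := by
  have hK : 1 < Nat.card K := Finite.one_lt_card
  have hK' : (1 : ℝ) < Nat.card K := by exact_mod_cast hK
  have h := Projectivization.card K V
  rw [Nat.card_congr (Projectivization.equivSubmodule K V),
    Module.natCard_eq_pow_finrank (K := K)] at h
  have h1 : 1 ≤ Nat.card K ^ finrank K V := Nat.one_le_pow _ _ (by omega)
  have h2 := congrArg (Nat.cast (R := ℝ)) h
  rw [Nat.cast_sub h1, Nat.cast_mul, Nat.cast_sub hK.le] at h2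
  push_cast at h2
  rw [gaussBinom_one_right, h2, mul_div_cancel_right₀]
  exact (sub_pos.2 hK').ne'

end Counting

/-- Double counting of flags (point, (k+1)-space): the spaces through a point P correspond to
k-spaces of V ⧸ P. The induction therefore has to quantify over all V. -/
theorem card_grass {K : Type*} [Field K] [Finite K] (k : ℕ) :
    ∀ (V : Type _) [AddCommGroup V] [Module K V] [FiniteDimensional K V],
      (Nat.card (Grass K V k) : ℝ) = gaussBinom (Nat.card K) (finrank K V) k := by
  have hK : 1 < Nat.card K := Finite.one_lt_card
  have hK' : (1 : ℝ) < Nat.card K := by exact_mod_cast hK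
  induction k with
  | zero =>
    intro V _ _ _
    rw [gaussBinom_zero_right]
    have : Unique (Grass K V 0) :=
      ⟨⟨⟨⊥, finrank_bot K V⟩⟩, fun A => Subtype.ext (Submodule.finrank_eq_zero.1 A.2)⟩
    simp
  | succ k ih =>
    intro V _ _ _
    obtain hV | ⟨n, hn⟩ : finrank K V = 0 ∨ ∃ n, finrank K V = n + 1 := by
      cases h : finrank K V with
      | zero => exact Or.inl rfl
      | succ n => exact Or.inr ⟨n, rfl⟩
    · rw [gaussBinom_eq_zero (by omega)]
      have : IsEmpty (Grass K V (k + 1)) :=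
        ⟨fun A => by have := Submodule.finrank_le A.1; have := A.2; omega⟩
      simp
    · have h1 : ∑ P : Grass K V 1, ∑ A : Grass K V (k + 1), inc P.1 A.1 =
          gaussBinom (Nat.card K) (n + 1) 1 * gaussBinom (Nat.card K) n k := by
        have : ∀ P : Grass K V 1, ∑ A : Grass K V (k + 1), inc P.1 A.1 =
            gaussBinom (Nat.card K) n k := by
          intro P
          have h3 := Submodule.finrank_quotient_add_finrank P.1
          have h4 : k + 1 - finrank K P.1 = k := by rw [P.2]; omega
          rw [P.2, hn] at h3
          rw [sum_inc_above P.1 (by rw [P.2]; omega), h4, ih]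
          congr 1
          omega
        rw [Finset.sum_congr rfl fun P _ => this P, Finset.sum_const, Finset.card_univ,
          ← Nat.card_eq_fintype_card, nsmul_eq_mul, card_grass_one, hn]
      have h2 : ∑ P : Grass K V 1, ∑ A : Grass K V (k + 1), inc P.1 A.1 =
          Nat.card (Grass K V (k + 1)) * gaussBinom (Nat.card K) (k + 1) 1 := by
        rw [Finset.sum_comm]
        have : ∀ A : Grass K V (k + 1), ∑ P : Grass K V 1, inc P.1 A.1 =
            gaussBinom (Nat.card K) (k + 1) 1 := by
          intro A
          rw [sum_inc_below, card_grass_one, A.2]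
        rw [Finset.sum_congr rfl fun P _ => this P, Finset.sum_const, Finset.card_univ,
          ← Nat.card_eq_fintype_card, nsmul_eq_mul]
      rw [h1, gaussBinom_one_right, gaussBinom_one_right] at h2
      rw [hn, gaussBinom_succ_succ]
      have h3 : (Nat.card K : ℝ) - 1 ≠ 0 := (sub_pos.2 hK').ne'
      have h4 : (Nat.card K : ℝ) ^ (k + 1) - 1 ≠ 0 :=
        (sub_pos.2 (one_lt_pow₀ hK' (by omega))).ne'
      field_simp at h2 ⊢
      linarith

/-! ### Counting subspaces above, below and between given ones -/

section IncidenceSums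

variable {K V : Type*} [Field K] [Finite K] [AddCommGroup V] [Module K V] [FiniteDimensional K V]

theorem sum_inc_above_eq_gaussBinom {U : Submodule K V} {j k : ℕ} (hU : finrank K U = j)
    (h : j ≤ k) :
    ∑ A : Grass K V k, inc U A.1 = gaussBinom (Nat.card K) (finrank K V - j) (k - j) := by
  subst hU
  rw [sum_inc_above U h, card_grass]
  congr 1
  have := Submodule.finrank_quotient_add_finrank U
  omega

theorem sum_inc_above_eq_zero {U : Submodule K V} {k : ℕ} (h : k < finrank K U) :
    ∑ A : Grass K V k, inc U A.1 = 0 := by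
  refine Finset.sum_eq_zero fun A _ => inc_of_not_le fun hUA => ?_
  have := Submodule.finrank_mono hUA
  have := A.2
  omega

theorem sum_inc_below_eq_gaussBinom (W : Submodule K V) (k : ℕ) :
    ∑ A : Grass K V k, inc A.1 W = gaussBinom (Nat.card K) (finrank K W) k := by
  rw [sum_inc_below, card_grass]

theorem sum_inc_below_mul (W : Submodule K V) (k : ℕ) (f : Submodule K V → ℝ) :
    ∑ A : Grass K V k, inc A.1 W * f A.1 = ∑ B : Grass K W k, f (B.1.map W.subtype) := by
  classical
  have h : ∀ A : Grass K V k, inc A.1 W * f A.1 = if A.1 ≤ W then f A.1 else 0 := by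
    intro A
    unfold inc
    split_ifs <;> simp
  rw [Finset.sum_congr rfl fun A _ => h A, ← Finset.sum_filter,
    Finset.sum_subtype (p := fun A : Grass K V k => A.1 ≤ W) _ (by simp)]
  exact Fintype.sum_equiv (grassBelowEquiv W k) _ _ fun A => by
    have := (grassBelowEquiv W k).symm_apply_apply A
    conv_lhs => rw [← this]
    rfl

theorem sum_inc_between_eq_gaussBinom {U W : Submodule K V} (hUW : U ≤ W) {j k : ℕ}
    (hU : finrank K U = j) (h : j ≤ k) :
    ∑ A : Grass K V k, inc A.1 W * inc U A.1 =
      gaussBinom (Nat.card K) (finrank K W - j) (k - j) := by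
  rw [sum_inc_below_mul W k (inc U)]
  rw [← sum_inc_above_eq_gaussBinom (U := U.comap W.subtype)
    ((Submodule.comapSubtypeEquivOfLe hUW).finrank_eq.trans hU) h]
  refine Finset.sum_congr rfl fun B _ => ?_
  unfold inc
  congr 1
  rw [eq_iff_iff]
  constructor
  · intro hB w hw
    obtain ⟨w', hw', e⟩ := hB hw
    rwa [← Subtype.ext e]
  · intro hB u hu
    exact ⟨⟨u, hUW hu⟩, hB hu, rfl⟩

end IncidenceSums

/-- The number of `k`-dimensional subspaces of an `n`-dimensional space that contain a given
`j`-dimensional one. -/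
noncomputable def upCount (q n k j : ℕ) : ℝ := if j ≤ k then gaussBinom q (n - j) (k - j) else 0

theorem finrank_sup_add_finrank_inf {K V : Type*} [Field K] [AddCommGroup V] [Module K V]
    [FiniteDimensional K V] {i j : ℕ} (P : Grass K V i) (L : Grass K V j) :
    finrank K (P.1 ⊔ L.1 : Submodule K V) + finrank K (P.1 ⊓ L.1 : Submodule K V) = i + j := by
  rw [Submodule.finrank_sup_add_finrank_inf_eq, P.2, L.2]

/-! ### Degrees, their squares, and the basic sum of squares -/

section QuadraticForms

variable {K V : Type*} [Field K] [Finite K] [AddCommGroup V] [Module K V] [FiniteDimensional K V]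

theorem sum_inc_eq_upCount {U : Submodule K V} {j : ℕ} (k : ℕ) (hU : finrank K U = j) :
    ∑ A : Grass K V k, inc U A.1 = upCount (Nat.card K) (finrank K V) k j := by
  unfold upCount
  split_ifs with h
  · exact sum_inc_above_eq_gaussBinom hU h
  · exact sum_inc_above_eq_zero (by omega)

variable {k : ℕ}

/-- The number of members of the family `F` that contain `U`. -/
noncomputable def deg (F : Finset (Grass K V k)) (U : Submodule K V) : ℝ := ∑ A ∈ F, inc U A.1

/-- The sum of the squares of the degrees of all `j`-dimensional subspaces. -/
noncomputable def degSq (F : Finset (Grass K V k)) (j : ℕ) : ℝ :=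
  ∑ L : Grass K V j, deg F L.1 ^ 2

/-- The sum of the degrees of the `j`-dimensional subspaces contained in `W`. -/
noncomputable def degBelow (F : Finset (Grass K V k)) (j : ℕ) (W : Submodule K V) : ℝ :=
  ∑ L : Grass K V j, deg F L.1 * inc L.1 W

/-- Expanding the square counts triples (L, A, B) with L inside A ∩ B. This links degrees to
intersection dimensions. -/
theorem degSq_eq_sum_gaussBinom (F : Finset (Grass K V k)) (j : ℕ) :
    degSq F j =
      ∑ A ∈ F, ∑ B ∈ F, gaussBinom (Nat.card K) (finrank K (A.1 ⊓ B.1 : Submodule K V)) j := by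
  unfold degSq deg
  simp only [sq, Finset.sum_mul_sum]
  rw [Finset.sum_comm]
  refine Finset.sum_congr rfl fun A _ => ?_
  rw [Finset.sum_comm]
  refine Finset.sum_congr rfl fun B _ => ?_
  simp only [inc_mul_inc_left, sum_inc_below_eq_gaussBinom]

theorem sum_deg (F : Finset (Grass K V k)) (j : ℕ) :
    ∑ L : Grass K V j, deg F L.1 = gaussBinom (Nat.card K) k j * F.card := by
  unfold deg
  rw [Finset.sum_comm, Finset.sum_congr rfl fun A _ =>
    (sum_inc_below_eq_gaussBinom A.1 j).trans (by rw [A.2]), Finset.sum_const, nsmul_eq_mul,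
    mul_comm]

theorem sum_degBelow_mem (F : Finset (Grass K V k)) (j : ℕ) :
    ∑ A ∈ F, degBelow F j A.1 = degSq F j := by
  unfold degBelow degSq
  rw [Finset.sum_comm]
  refine Finset.sum_congr rfl fun L _ => ?_
  rw [← Finset.mul_sum, sq]
  rfl

theorem sum_degBelow (F : Finset (Grass K V k)) (j : ℕ) :
    ∑ A : Grass K V k, degBelow F j A.1 =
      upCount (Nat.card K) (finrank K V) k j * (gaussBinom (Nat.card K) k j * F.card) := by
  unfold degBelow
  rw [Finset.sum_comm, ← sum_deg F j, Finset.mul_sum]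
  refine Finset.sum_congr rfl fun L _ => ?_
  rw [← Finset.mul_sum, sum_inc_eq_upCount k L.2, mul_comm]

/-- A contains P and L exactly when it contains their join, and the number of such A depends only on
the dimension of the join. The three lemmas evaluating this for points and lines classify the
relative positions. -/
theorem sum_degBelow_mul_degBelow (F : Finset (Grass K V k)) (i j : ℕ) :
    ∑ A : Grass K V k, degBelow F i A.1 * degBelow F j A.1 =
      ∑ P : Grass K V i, ∑ L : Grass K V j, deg F P.1 * deg F L.1 *
        upCount (Nat.card K) (finrank K V) k (finrank K (P.1 ⊔ L.1 : Submodule K V)) := by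
  unfold degBelow
  simp only [Finset.sum_mul_sum]
  rw [Finset.sum_comm]
  refine Finset.sum_congr rfl fun P _ => ?_
  rw [Finset.sum_comm]
  refine Finset.sum_congr rfl fun L _ => ?_
  rw [← sum_inc_eq_upCount k rfl, Finset.mul_sum]
  refine Finset.sum_congr rfl fun A _ => ?_
  rw [← inc_mul_inc_right]
  ring

theorem sum_inc_mul_deg (F : Finset (Grass K V k)) {j : ℕ} {U : Submodule K V} {i : ℕ}
    (hU : finrank K U = i) (h : i ≤ j) :
    ∑ L : Grass K V j, inc U L.1 * deg F L.1 =
      gaussBinom (Nat.card K) (k - i) (j - i) * deg F U := by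
  unfold deg
  simp only [Finset.mul_sum]
  rw [Finset.sum_comm]
  refine Finset.sum_congr rfl fun A _ => ?_
  by_cases hUA : U ≤ A.1
  · rw [inc_of_le hUA, mul_one]
    have := sum_inc_between_eq_gaussBinom hUA hU h
    rw [A.2] at this
    rw [← this]
    exact Finset.sum_congr rfl fun L _ => mul_comm _ _
  · rw [inc_of_not_le hUA, mul_zero]
    refine Finset.sum_eq_zero fun L _ => ?_
    by_cases h1 : U ≤ L.1
    · rw [inc_of_not_le (fun h2 => hUA (h1.trans h2)), mul_zero]
    · rw [inc_of_not_le h1, zero_mul]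

/-- Two points either coincide or span a line. -/
theorem sum_degBelow_one_sq (F : Finset (Grass K V k)) :
    ∑ A : Grass K V k, degBelow F 1 A.1 * degBelow F 1 A.1 =
      (upCount (Nat.card K) (finrank K V) k 1 - upCount (Nat.card K) (finrank K V) k 2) *
        degSq F 1 +
      upCount (Nat.card K) (finrank K V) k 2 * (gaussBinom (Nat.card K) k 1 * F.card) ^ 2 := by
  classical
  have h : ∀ P R : Grass K V 1,
      upCount (Nat.card K) (finrank K V) k (finrank K (P.1 ⊔ R.1 : Submodule K V)) =
        upCount (Nat.card K) (finrank K V) k 2 + if P = R then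
          upCount (Nat.card K) (finrank K V) k 1 - upCount (Nat.card K) (finrank K V) k 2
          else 0 := by
    intro P R
    split_ifs with hPR
    · subst hPR
      rw [sup_idem, P.2]
      ring
    · rw [add_zero]
      congr 1
      have h1 := finrank_sup_add_finrank_inf P R
      have h2 : finrank K (P.1 ⊓ R.1 : Submodule K V) ≠ 1 := by
        intro h3
        apply hPR
        apply Subtype.ext
        have h4 : P.1 ⊓ R.1 = P.1 := Submodule.eq_of_le_of_finrank_eq inf_le_left (h3.trans P.2.symm)
        have h5 : P.1 ⊓ R.1 = R.1 := Submodule.eq_of_le_of_finrank_eq inf_le_right (h3.trans R.2.symm)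
        rw [← h4, h5]
      have h3 : finrank K (P.1 ⊓ R.1 : Submodule K V) ≤ 1 :=
        (Submodule.finrank_mono inf_le_left).trans P.2.le
      omega
  rw [sum_degBelow_mul_degBelow, ← sum_deg F 1, sq (∑ L : Grass K V 1, deg F L.1),
    Finset.sum_mul_sum, degSq, Finset.mul_sum,
    Finset.mul_sum, ← Finset.sum_add_distrib]
  refine Finset.sum_congr rfl fun P _ => ?_
  simp only [h, mul_add, Finset.sum_add_distrib, mul_ite, mul_zero, Finset.sum_ite_eq,
    Finset.mem_univ, if_true]
  rw [Finset.mul_sum, add_comm]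
  congr 1
  · ring
  · exact Finset.sum_congr rfl fun R _ => by ring

/-- A point lies on a line or spans a 3-space with it; the incident pairs collapse to point degrees
by `sum_inc_mul_deg`. -/
theorem sum_degBelow_one_mul_two (F : Finset (Grass K V k)) :
    ∑ A : Grass K V k, degBelow F 1 A.1 * degBelow F 2 A.1 =
      (upCount (Nat.card K) (finrank K V) k 2 - upCount (Nat.card K) (finrank K V) k 3) *
        (gaussBinom (Nat.card K) (k - 1) 1 * degSq F 1) +
      upCount (Nat.card K) (finrank K V) k 3 *
        ((gaussBinom (Nat.card K) k 1 * F.card) * (gaussBinom (Nat.card K) k 2 * F.card)) := by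
  have h : ∀ (P : Grass K V 1) (L : Grass K V 2),
      upCount (Nat.card K) (finrank K V) k (finrank K (P.1 ⊔ L.1 : Submodule K V)) =
        upCount (Nat.card K) (finrank K V) k 3 + inc P.1 L.1 *
          (upCount (Nat.card K) (finrank K V) k 2 - upCount (Nat.card K) (finrank K V) k 3) := by
    intro P L
    by_cases hPL : P.1 ≤ L.1
    · rw [inc_of_le hPL, sup_eq_right.2 hPL, L.2]
      ring
    · rw [inc_of_not_le hPL, zero_mul, add_zero]
      congr 1
      have h1 := finrank_sup_add_finrank_inf P L
      have h2 : finrank K (P.1 ⊓ L.1 : Submodule K V) ≠ 1 := by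
        intro h3
        apply hPL
        exact inf_eq_left.1 (Submodule.eq_of_le_of_finrank_eq inf_le_left (h3.trans P.2.symm))
      have h3 : finrank K (P.1 ⊓ L.1 : Submodule K V) ≤ 1 :=
        (Submodule.finrank_mono inf_le_left).trans P.2.le
      omega
  rw [sum_degBelow_mul_degBelow, ← sum_deg F 1, ← sum_deg F 2, Finset.sum_mul_sum, degSq,
    Finset.mul_sum, Finset.mul_sum, Finset.mul_sum, ← Finset.sum_add_distrib]
  refine Finset.sum_congr rfl fun P _ => ?_
  have h1 := sum_inc_mul_deg F (j := 2) P.2 (by omega)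
  rw [show gaussBinom (Nat.card K) (k - 1) 1 * deg F P.1 ^ 2 =
    (gaussBinom (Nat.card K) (k - 1) (2 - 1) * deg F P.1) * deg F P.1 by ring, ← h1,
    Finset.sum_mul, Finset.mul_sum, Finset.mul_sum, ← Finset.sum_add_distrib]
  refine Finset.sum_congr rfl fun L _ => ?_
  rw [h]
  ring

/-- Two lines share 0, 1 or q + 1 points. A function affine in this number fits the first two cases,
and the coefficient v of `degSq F 2` is the correction needed when the lines are equal. -/
theorem sum_degBelow_two_sq (F : Finset (Grass K V k)) :
    ∑ A : Grass K V k, degBelow F 2 A.1 * degBelow F 2 A.1 =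
      (upCount (Nat.card K) (finrank K V) k 2 -
          (Nat.card K + 1) * upCount (Nat.card K) (finrank K V) k 3 +
          Nat.card K * upCount (Nat.card K) (finrank K V) k 4) * degSq F 2 +
      (upCount (Nat.card K) (finrank K V) k 3 - upCount (Nat.card K) (finrank K V) k 4) *
        (gaussBinom (Nat.card K) (k - 1) 1 ^ 2 * degSq F 1) +
      upCount (Nat.card K) (finrank K V) k 4 * (gaussBinom (Nat.card K) k 2 * F.card) ^ 2 := by
  classical
  have hK : (Nat.card K : ℝ) - 1 ≠ 0 := by
    have : 1 < Nat.card K := Finite.one_lt_card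
    exact (sub_pos.2 (by exact_mod_cast this)).ne'
  set r2 := upCount (Nat.card K) (finrank K V) k 2
  set r3 := upCount (Nat.card K) (finrank K V) k 3
  set r4 := upCount (Nat.card K) (finrank K V) k 4
  set v := r2 - (Nat.card K + 1) * r3 + Nat.card K * r4 with hv
  have h : ∀ L R : Grass K V 2,
      upCount (Nat.card K) (finrank K V) k (finrank K (L.1 ⊔ R.1 : Submodule K V)) =
        r4 + (r3 - r4) * (∑ P : Grass K V 1, inc P.1 L.1 * inc P.1 R.1) +
          if L = R then v else 0 := by
    intro L R
    have h0 : ∑ P : Grass K V 1, inc P.1 L.1 * inc P.1 R.1 =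
        gaussBinom (Nat.card K) (finrank K (L.1 ⊓ R.1 : Submodule K V)) 1 := by
      simp only [inc_mul_inc_left, sum_inc_below_eq_gaussBinom]
    rw [h0, gaussBinom_one_right]
    split_ifs with hLR
    · subst hLR
      rw [sup_idem, inf_idem, L.2, hv]
      field_simp
      ring
    · have h1 := finrank_sup_add_finrank_inf L R
      have h2 : finrank K (L.1 ⊓ R.1 : Submodule K V) ≠ 2 := by
        intro h3
        apply hLR
        apply Subtype.ext
        have h4 : L.1 ⊓ R.1 = L.1 := Submodule.eq_of_le_of_finrank_eq inf_le_left (h3.trans L.2.symm)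
        have h5 : L.1 ⊓ R.1 = R.1 := Submodule.eq_of_le_of_finrank_eq inf_le_right (h3.trans R.2.symm)
        rw [← h4, h5]
      have h3 : finrank K (L.1 ⊓ R.1 : Submodule K V) ≤ 2 :=
        (Submodule.finrank_mono inf_le_left).trans L.2.le
      obtain h4 | h4 : finrank K (L.1 ⊓ R.1 : Submodule K V) = 0 ∨
          finrank K (L.1 ⊓ R.1 : Submodule K V) = 1 := by omega
      · rw [h4, show finrank K (L.1 ⊔ R.1 : Submodule K V) = 4 by omega]
        simp [r4]
      · rw [h4, show finrank K (L.1 ⊔ R.1 : Submodule K V) = 3 by omega, pow_one, div_self hK]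
        simp [r3]
  -- For each point P, the degrees of the lines through P add up to [k-1]_1 · deg P; square this and
  -- sum over P.
  have h6 : gaussBinom (Nat.card K) (k - 1) 1 ^ 2 * degSq F 1 =
      ∑ L : Grass K V 2, ∑ R : Grass K V 2, deg F L.1 * deg F R.1 *
        ∑ P : Grass K V 1, inc P.1 L.1 * inc P.1 R.1 := by
    have : gaussBinom (Nat.card K) (k - 1) 1 ^ 2 * degSq F 1 = ∑ P : Grass K V 1,
        ∑ L : Grass K V 2, ∑ R : Grass K V 2,
          inc P.1 L.1 * deg F L.1 * (inc P.1 R.1 * deg F R.1) := by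
      rw [degSq, Finset.mul_sum]
      refine Finset.sum_congr rfl fun P _ => ?_
      rw [← Finset.sum_mul_sum, sum_inc_mul_deg F (j := 2) P.2 (by omega)]
      ring
    rw [this]
    simp only [Finset.mul_sum]
    rw [Finset.sum_comm]
    refine Finset.sum_congr rfl fun L _ => ?_
    rw [Finset.sum_comm]
    exact Finset.sum_congr rfl fun R _ => Finset.sum_congr rfl fun P _ => by ring
  rw [sum_degBelow_mul_degBelow, ← sum_deg F 2, sq (∑ L : Grass K V 2, deg F L.1),
    Finset.sum_mul_sum, h6, degSq, Finset.mul_sum,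
    Finset.mul_sum, Finset.mul_sum, ← Finset.sum_add_distrib, ← Finset.sum_add_distrib]
  refine Finset.sum_congr rfl fun L _ => ?_
  simp only [h, mul_add, Finset.sum_add_distrib, mul_ite, mul_zero, Finset.sum_ite_eq,
    Finset.mem_univ, if_true]
  have h7 : ∑ R : Grass K V 2, deg F L.1 * deg F R.1 * r4 =
      r4 * ∑ R : Grass K V 2, deg F L.1 * deg F R.1 := by
    rw [Finset.mul_sum]
    exact Finset.sum_congr rfl fun R _ => by ring
  have h8 : ∑ R : Grass K V 2, deg F L.1 * deg F R.1 *
        ((r3 - r4) * ∑ P : Grass K V 1, inc P.1 L.1 * inc P.1 R.1) =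
      (r3 - r4) * ∑ R : Grass K V 2, deg F L.1 * deg F R.1 *
        ∑ P : Grass K V 1, inc P.1 L.1 * inc P.1 R.1 := by
    rw [Finset.mul_sum]
    exact Finset.sum_congr rfl fun R _ => by ring
  rw [h7, h8]
  ring

theorem sum_sq_linear_combination {ι : Type*} [Fintype ι] (f g h : ι → ℝ) (a b c d : ℝ) :
    ∑ i, (a * f i + b * g i + c * h i + d) ^ 2 =
      a ^ 2 * ∑ i, f i * f i + b ^ 2 * ∑ i, g i * g i + c ^ 2 * ∑ i, h i * h i +
        d ^ 2 * Fintype.card ι + 2 * a * b * ∑ i, f i * g i + 2 * a * c * ∑ i, f i * h i +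
        2 * b * c * ∑ i, g i * h i + 2 * a * d * ∑ i, f i + 2 * b * d * ∑ i, g i +
        2 * c * d * ∑ i, h i := by
  rw [← Finset.card_univ, Finset.cast_card]
  simp only [Finset.mul_sum, ← Finset.sum_add_distrib]
  exact Finset.sum_congr rfl fun i _ => by ring

/-- The sum of the squares of a function built from the family and its degrees, in terms of
the degree squares of points and lines. -/
theorem sum_sq_degBelow_nonneg (F : Finset (Grass K V k)) {q n : ℕ} (hq : Nat.card K = q)
    (hn : finrank K V = n) (a b c d : ℝ) :
    0 ≤ a ^ 2 * F.card +
      b ^ 2 * ((upCount q n k 1 - upCount q n k 2) * degSq F 1 +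
        upCount q n k 2 * (gaussBinom q k 1 * F.card) ^ 2) +
      c ^ 2 * ((upCount q n k 2 - (q + 1) * upCount q n k 3 + q * upCount q n k 4) * degSq F 2 +
        (upCount q n k 3 - upCount q n k 4) * (gaussBinom q (k - 1) 1 ^ 2 * degSq F 1) +
        upCount q n k 4 * (gaussBinom q k 2 * F.card) ^ 2) +
      d ^ 2 * gaussBinom q n k + 2 * a * b * degSq F 1 + 2 * a * c * degSq F 2 +
      2 * b * c * ((upCount q n k 2 - upCount q n k 3) * (gaussBinom q (k - 1) 1 * degSq F 1) +
        upCount q n k 3 * ((gaussBinom q k 1 * F.card) * (gaussBinom q k 2 * F.card))) +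
      2 * a * d * F.card +
      2 * b * d * (upCount q n k 1 * (gaussBinom q k 1 * F.card)) +
      2 * c * d * (upCount q n k 2 * (gaussBinom q k 2 * F.card)) := by
  classical
  subst hq hn
  have h := sum_sq_linear_combination (ι := Grass K V k) (fun A => if A ∈ F then 1 else 0)
    (fun A => degBelow F 1 A.1) (fun A => degBelow F 2 A.1) a b c d
  have h1 : ((Fintype.card (Grass K V k) : ℕ) : ℝ) = gaussBinom (Nat.card K) (finrank K V) k := by
    rw [← card_grass, Nat.card_eq_fintype_card]
  have h2 : ∀ f : Grass K V k → ℝ, ∑ A : Grass K V k, (if A ∈ F then (1 : ℝ) else 0) * f A =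
      ∑ A ∈ F, f A := by
    intro f
    simp [ite_mul, Finset.sum_ite_mem]
  rw [h2, h2, h2, sum_degBelow_one_sq, sum_degBelow_two_sq, sum_degBelow_one_mul_two,
    sum_degBelow_mem, sum_degBelow_mem, sum_degBelow, sum_degBelow, h1] at h
  have h3 : ∑ A ∈ F, (if A ∈ F then (1 : ℝ) else 0) = F.card := by
    rw [Finset.sum_ite_mem, Finset.inter_self]
    simp
  have h4 : ∑ A : Grass K V k, (if A ∈ F then (1 : ℝ) else 0) = F.card := by
    simp
  rw [h3, h4] at h
  rw [← h]
  exact Finset.sum_nonneg fun A _ => sq_nonneg _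

end QuadraticForms

/-! ### Ratios of the counts and the estimates for points -/

/-- Kept in product form so that it also covers j ≥ k, where both sides vanish. The case k = 3,
where no k-space contains a 4-space, relies on this. -/
theorem upCount_succ_mul {q n k : ℕ} (hq : 1 < q) (hkn : k ≤ n) (j : ℕ) :
    upCount q n k (j + 1) * ((q : ℝ) ^ (n - j) - 1) =
      upCount q n k j * ((q : ℝ) ^ (k - j) - 1) := by
  have hq' : (1 : ℝ) < q := by exact_mod_cast hq
  unfold upCount
  rcases lt_trichotomy j k with h | h | h
  · rw [if_pos (by omega), if_pos (by omega)]
    obtain ⟨k', hk'⟩ : ∃ k', k - j = k' + 1 := ⟨k - j - 1, by omega⟩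
    obtain ⟨n', hn'⟩ : ∃ n', n - j = n' + 1 := ⟨n - j - 1, by omega⟩
    rw [show n - (j + 1) = n' by omega, show k - (j + 1) = k' by omega, hk', hn',
      gaussBinom_succ_succ]
    have : (q : ℝ) ^ (k' + 1) - 1 ≠ 0 := (sub_pos.2 (one_lt_pow₀ hq' (by omega))).ne'
    field_simp
  · subst h
    simp
  · rw [if_neg (by omega), if_neg (by omega)]
    simp

theorem upCount_zero (q n k : ℕ) : upCount q n k 0 = gaussBinom q n k := by
  simp [upCount]

theorem one_le_gaussBinom {q : ℕ} (hq : 1 < q) {n k : ℕ} (hkn : k ≤ n) :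
    1 ≤ gaussBinom q n k := by
  have hq' : (1 : ℝ) < q := by exact_mod_cast hq
  induction k generalizing n with
  | zero => rw [gaussBinom_zero_right]
  | succ k ih =>
    obtain ⟨m, rfl⟩ : ∃ m, n = m + 1 := ⟨n - 1, by omega⟩
    rw [gaussBinom_succ_succ]
    refine one_le_mul_of_one_le_of_one_le ?_ (ih (by omega))
    rw [one_le_div (sub_pos.2 (one_lt_pow₀ hq' (by omega)))]
    exact sub_le_sub_right (pow_le_pow_right₀ hq'.le hkn) 1

/-- The difference [d+i]_1 - [d]_1 is a sum of i powers of q, each at most q^(d+i-1). The factor q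
avoids the exponent d + i - 1. -/
theorem gaussBinom_one_sub_le {q : ℝ} (hq : 1 < q) (d i : ℕ) :
    (q ^ (d + i) - q ^ d) / (q - 1) * q ≤ i * q ^ (d + i) := by
  have h0 : 0 < q - 1 := sub_pos.2 hq
  induction i with
  | zero => simp
  | succ i ih =>
    have h1 : (q ^ (d + (i + 1)) - q ^ d) / (q - 1) * q =
        (q ^ (d + i) - q ^ d) / (q - 1) * q + q ^ (d + i) * q := by
      field_simp
      ring
    have h2 : (i : ℝ) * q ^ (d + i) ≤ i * q ^ (d + i) * q :=
      le_mul_of_one_le_right (by positivity) hq.le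
    rw [h1]
    push_cast
    calc _ ≤ (i : ℝ) * q ^ (d + i) * q + q ^ (d + i) * q := by linarith
      _ = _ := by ring

/-- Here y = q^(k-1), t = q^(n-k), and r_i counts the k-spaces above an i-space. The hypothesis `h`
is ‖f‖² ≥ 0 for f = (r₁ - r₂)·1_F - D₁ + const, and `key` says that ‖f‖² = (r₁ - r₂)⟨1_F, f⟩. -/
theorem points_degSq_le {q y t N r₁ r₂ M Q : ℝ} (hq : 1 < q) (hy : 1 ≤ y) (ht : 1 < t)
    (hr₁ : 1 ≤ r₁) (hN : r₁ * (q * y * t - 1) = N * (q * y - 1))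
    (hr₂ : r₂ * (y * t - 1) = r₁ * (y - 1))
    (h : 0 ≤ (r₁ - r₂) ^ 2 * M +
      (-1) ^ 2 * ((r₁ - r₂) * Q + r₂ * ((q * y - 1) / (q - 1) * M) ^ 2) +
      (r₂ * ((q * y - 1) / (q - 1)) / r₁ * M) ^ 2 * N + 2 * (r₁ - r₂) * (-1) * Q +
      2 * (r₁ - r₂) * (r₂ * ((q * y - 1) / (q - 1)) / r₁ * M) * M +
      2 * (-1) * (r₂ * ((q * y - 1) / (q - 1)) / r₁ * M) *
        (r₁ * ((q * y - 1) / (q - 1) * M))) :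
    Q ≤ (r₁ - r₂) * M + r₂ * ((q * y - 1) / (q - 1)) / r₁ * M ^ 2 := by
  have h1 : 0 < q - 1 := by linarith
  have h2 : 1 < q * y := by nlinarith
  have h3 : 1 < y * t := by nlinarith
  have h4 : 0 < y * t - 1 := by linarith
  have h5 : 0 < q * y - 1 := by linarith
  have hr₂' : r₂ = r₁ * (y - 1) / (y * t - 1) := by rw [eq_div_iff h4.ne', hr₂]
  have hN' : N = r₁ * (q * y * t - 1) / (q * y - 1) := by rw [eq_div_iff h5.ne', hN]
  have hw : 0 < r₁ - r₂ := by
    have : r₁ - r₂ = r₁ * (y * (t - 1)) / (y * t - 1) := by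
      rw [hr₂']
      field_simp
      ring
    rw [this]
    have : 0 < t - 1 := by linarith
    positivity
  have key : (r₁ - r₂) ^ 2 * M +
      (-1) ^ 2 * ((r₁ - r₂) * Q + r₂ * ((q * y - 1) / (q - 1) * M) ^ 2) +
      (r₂ * ((q * y - 1) / (q - 1)) / r₁ * M) ^ 2 * N + 2 * (r₁ - r₂) * (-1) * Q +
      2 * (r₁ - r₂) * (r₂ * ((q * y - 1) / (q - 1)) / r₁ * M) * M +
      2 * (-1) * (r₂ * ((q * y - 1) / (q - 1)) / r₁ * M) *
        (r₁ * ((q * y - 1) / (q - 1) * M)) =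
      (r₁ - r₂) * ((r₁ - r₂) * M + r₂ * ((q * y - 1) / (q - 1)) / r₁ * M ^ 2 - Q) := by
    have hr₁' : r₁ ≠ 0 := by positivity
    rw [hN', hr₂']
    field_simp
    ring
  rw [key] at h
  have := nonneg_of_mul_nonneg_right h hw
  linarith

theorem points_bound_eq {q y t N r₁ r₂ M k : ℝ} (hq : 1 < q) (hy : 1 ≤ y) (ht : 1 < t)
    (hr₁ : 1 ≤ r₁) (hM : 0 < M) (hN : r₁ * (q * y * t - 1) = N * (q * y - 1))
    (hr₂ : r₂ * (y * t - 1) = r₁ * (y - 1)) :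
    k * M ^ 2 - ((q * y - 1) / (q - 1) / y - r₂ * ((q * y - 1) / (q - 1)) / r₁ / y) * M ^ 2 +
      ((r₁ - r₂) / y + (q * y - 1) / (q - 1) / y + -1 / y * ((q * y - 1) / (q - 1))) * M =
    (N / M - (q * y * t - 1) / (q - 1)) *
      (q * M ^ 2 * ((q * y - 1) / (q - 1)) * ((t - 1) / (q - 1)) /
        ((q * y * t - 1) / (q - 1) * ((q * y * t - 1) / (q - 1) - 1))) + k * M ^ 2 := by
  have h1 : 0 < q - 1 := by linarith
  have h2 : 1 < q * y := by nlinarith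
  have h3 : 1 < y * t := by nlinarith
  have h6 : 1 < q * y * t := by nlinarith
  have h4 : 0 < y * t - 1 := by linarith
  have h5 : 0 < q * y - 1 := by linarith
  have h7 : 0 < q * y * t - 1 := by linarith
  have hr₂' : r₂ = r₁ * (y - 1) / (y * t - 1) := by rw [eq_div_iff h4.ne', hr₂]
  have hN' : N = r₁ * (q * y * t - 1) / (q * y - 1) := by rw [eq_div_iff h5.ne', hN]
  have hb : (q * y * t - 1) / (q - 1) - 1 = q * (y * t - 1) / (q - 1) := by
    field_simp
    ring
  have hr₁' : r₁ ≠ 0 := by positivity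
  have hy' : y ≠ 0 := by positivity
  rw [hb, hN', hr₂']
  field_simp
  ring

/-! ### From minorants to bounds; the first inequality -/

section Certificate

variable {K V : Type*} [Field K] [Finite K] [AddCommGroup V] [Module K V] [FiniteDimensional K V]
  {k : ℕ}

/-- A quadratic minorant of the distance yields an upper bound for the total intersection
number. -/
theorem totalInt_le_of_minorant (F : Finset (Grass K V k)) {q : ℕ} (hq : Nat.card K = q)
    (a b c s t : ℝ)
    (hpt : ∀ d < k, a + b * gaussBinom q d 1 - c * gaussBinom q d 2 ≤ k - d)
    (hdeg : c * degSq F 2 - b * degSq F 1 ≤ s * F.card + t * (F.card : ℝ) ^ 2) :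
    (totalInt F : ℝ) ≤ k * (F.card : ℝ) ^ 2 - (a - t) * (F.card : ℝ) ^ 2 +
      (s + a + b * gaussBinom q k 1 - c * gaussBinom q k 2) * F.card := by
  classical
  subst hq
  set g : ℕ → ℝ := fun d => a + b * gaussBinom (Nat.card K) d 1 - c * gaussBinom (Nat.card K) d 2
    with hg
  have h1 : ∀ A B : Grass K V k, (finrank K (A.1 ⊓ B.1 : Submodule K V) : ℝ) ≤
      k - g (finrank K (A.1 ⊓ B.1 : Submodule K V)) + if A = B then g k else 0 := by
    intro A B
    split_ifs with hAB
    · subst hAB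
      rw [inf_idem, A.2]
      linarith
    · have h2 : finrank K (A.1 ⊓ B.1 : Submodule K V) ≠ k := by
        intro h3
        apply hAB
        apply Subtype.ext
        have h4 : A.1 ⊓ B.1 = A.1 := Submodule.eq_of_le_of_finrank_eq inf_le_left (h3.trans A.2.symm)
        have h5 : A.1 ⊓ B.1 = B.1 := Submodule.eq_of_le_of_finrank_eq inf_le_right (h3.trans B.2.symm)
        rw [← h4, h5]
      have h3 : finrank K (A.1 ⊓ B.1 : Submodule K V) ≤ k :=
        (Submodule.finrank_mono inf_le_left).trans A.2.le
      have := hpt _ (lt_of_le_of_ne h3 h2)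
      simp only [hg]
      linarith
  have h2 : (totalInt F : ℝ) ≤ ∑ A ∈ F, ∑ B ∈ F,
      (k - g (finrank K (A.1 ⊓ B.1 : Submodule K V)) + if A = B then g k else 0) := by
    unfold totalInt
    push_cast
    exact Finset.sum_le_sum fun A _ => Finset.sum_le_sum fun B _ => h1 A B
  have h3 : ∑ A ∈ F, ∑ B ∈ F,
      (k - g (finrank K (A.1 ⊓ B.1 : Submodule K V)) + if A = B then g k else 0) =
      (k - a) * (F.card : ℝ) ^ 2 - b * degSq F 1 + c * degSq F 2 + g k * F.card := by
    rw [degSq_eq_sum_gaussBinom, degSq_eq_sum_gaussBinom]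
    have e1 : (k - a) * (F.card : ℝ) ^ 2 = ∑ A ∈ F, ∑ B ∈ F, ((k : ℝ) - a) := by
      simp
      ring
    have e2 : g k * F.card = ∑ A ∈ F, ∑ B ∈ F, if A = B then g k else 0 := by
      simp
      ring
    rw [e1, e2]
    simp only [Finset.mul_sum, ← Finset.sum_add_distrib, ← Finset.sum_sub_distrib]
    refine Finset.sum_congr rfl fun A _ => Finset.sum_congr rfl fun B _ => ?_
    simp only [hg]
    ring
  rw [h3] at h2
  simp only [hg] at h2
  linarith

theorem totalInt_le_mul_card_sq (F : Finset (Grass K V k)) :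
    (totalInt F : ℝ) ≤ k * (F.card : ℝ) ^ 2 := by
  have := totalInt_le_of_minorant F rfl 0 0 0 0 0
    (fun d hd => by have : (d : ℝ) ≤ k := by exact_mod_cast hd.le
                    linarith) (by simp)
  simpa using this

theorem totalInt_le_of_one_le (F : Finset (Grass K V k)) :
    (totalInt F : ℝ) ≤ k * (F.card : ℝ) ^ 2 - (F.card : ℝ) ^ 2 + F.card := by
  have := totalInt_le_of_minorant F rfl 1 0 0 0 0
    (fun d hd => by have : (d : ℝ) + 1 ≤ k := by exact_mod_cast hd
                    linarith) (by simp)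
  simpa using this

theorem totalInt_le_points (F : Finset (Grass K V k)) {q n : ℕ} (hq : Nat.card K = q)
    (hn : finrank K V = n) (hk : 1 ≤ k) (hkn : k ≤ n) (hF : 1 ≤ F.card) :
    (totalInt F : ℝ) ≤
        (gaussBinom q n k / F.card - gaussBinom q n 1) *
          (q * (F.card : ℝ) ^ 2 * gaussBinom q k 1 * gaussBinom q (n - k) 1 /
            (gaussBinom q n 1 * (gaussBinom q n 1 - 1))) + k * (F.card : ℝ) ^ 2 := by
  obtain rfl | hkn' := hkn.eq_or_lt
  -- For k = n the factor [n-k]_1 vanishes, and so does the fraction, even in the form 0/0; only the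
  -- trivial bound k M² remains.
  · simpa [gaussBinom_one_right] using totalInt_le_mul_card_sq F
  have hq1 : 1 < q := by rw [← hq]; exact Finite.one_lt_card
  have hq' : (1 : ℝ) < q := by exact_mod_cast hq1
  have hM : (0 : ℝ) < F.card := by exact_mod_cast hF
  obtain ⟨k, rfl⟩ : ∃ k', k = k' + 1 := ⟨k - 1, by omega⟩
  obtain ⟨m, rfl⟩ : ∃ m, n = k + 1 + (m + 1) := ⟨n - k - 2, by omega⟩
  have hr0 := upCount_succ_mul hq1 hkn 0
  have hr1 := upCount_succ_mul hq1 hkn 1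
  have hrpos : 1 ≤ upCount q (k + 1 + (m + 1)) (k + 1) 1 := by
    unfold upCount
    rw [if_pos (by omega)]
    exact one_le_gaussBinom hq1 (by omega)
  rw [upCount_zero] at hr0
  have hA := sum_sq_degBelow_nonneg F hq hn
    (upCount q (k + 1 + (m + 1)) (k + 1) 1 - upCount q (k + 1 + (m + 1)) (k + 1) 2) (-1) 0
    (upCount q (k + 1 + (m + 1)) (k + 1) 2 * gaussBinom q (k + 1) 1 /
      upCount q (k + 1 + (m + 1)) (k + 1) 1 * F.card)
  have hX1 : 1 ≤ (q : ℝ) ^ k := one_le_pow₀ hq'.le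
  have hX0 : (0 : ℝ) < (q : ℝ) ^ k := by linarith
  have hT1 : 1 < (q : ℝ) ^ (m + 1) := one_lt_pow₀ hq' (by omega)
  have e1 : (q : ℝ) ^ (k + 1) = q * q ^ k := pow_succ' _ _
  have e2 : (q : ℝ) ^ (k + 1 + (m + 1)) = q * q ^ k * q ^ (m + 1) := by rw [pow_add, e1]
  have e3 : (q : ℝ) ^ (k + (m + 1)) = q ^ k * q ^ (m + 1) := pow_add _ _ _
  rw [Nat.sub_zero, Nat.sub_zero, e1, e2] at hr0
  rw [show k + 1 + (m + 1) - 1 = k + (m + 1) by omega, Nat.add_sub_cancel, e3] at hr1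
  have hb := points_degSq_le (M := F.card) (Q := degSq F 1) hq' hX1 hT1 hrpos hr0 hr1 (by
    rw [gaussBinom_one_right, e1] at hA
    linarith)
  -- With k now standing for the old k - 1, the minorant is ([k+1]_1 - [d]_1)/q^k. It vanishes at d
  -- = k + 1, so the diagonal costs nothing.
  have hcert := totalInt_le_of_minorant F hq ((q * q ^ k - 1) / (q - 1) / q ^ k) (-1 / q ^ k) 0
    ((upCount q (k + 1 + (m + 1)) (k + 1) 1 - upCount q (k + 1 + (m + 1)) (k + 1) 2) / q ^ k)
    (upCount q (k + 1 + (m + 1)) (k + 1) 2 * ((q * q ^ k - 1) / (q - 1)) /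
      upCount q (k + 1 + (m + 1)) (k + 1) 1 / q ^ k) (by
        intro d hd
        obtain ⟨i, hi⟩ : ∃ i, k + 1 = d + i := ⟨k + 1 - d, by omega⟩
        have h1 := gaussBinom_one_sub_le hq' d i
        rw [← hi, e1] at h1
        have h2 : ((k + 1 : ℕ) : ℝ) - d = i := by
          rw [hi]
          push_cast
          ring
        have h3 : (q : ℝ) - 1 ≠ 0 := by linarith
        rw [h2, gaussBinom_one_right]
        have h4 : ((q : ℝ) * q ^ k - q ^ d) / (q - 1) ≤ i * q ^ k := by
          refine le_of_mul_le_mul_right ?_ (zero_lt_one.trans hq')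
          linarith
        calc _ = ((q : ℝ) * q ^ k - q ^ d) / (q - 1) / q ^ k := by
              field_simp
              ring
          _ ≤ i := by rwa [div_le_iff₀ hX0]) (by
        have := div_le_div_of_nonneg_right hb hX0.le
        calc _ = degSq F 1 / q ^ k := by ring
          _ ≤ _ := this
          _ = _ := by ring)
  refine hcert.trans_eq ?_
  simp only [gaussBinom_one_right, zero_mul, sub_zero]
  rw [show k + 1 + (m + 1) - (k + 1) = m + 1 by omega, e1, e2]
  exact points_bound_eq hq' hX1 hT1 hrpos hM hr0 hr1

end Certificate

/-! ### Degree squares of lines -/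

theorem gaussBinom_two_right {q : ℕ} (d : ℕ) :
    gaussBinom q d 2 = ((q : ℝ) ^ d - 1) * ((q : ℝ) ^ (d - 1) - 1) /
      (((q : ℝ) ^ 2 - 1) * ((q : ℝ) - 1)) := by
  simp [gaussBinom, Finset.prod_range_succ]

/-- With `x = q ^ (k - 2)` and `z = q ^ (n - k - 1)`: the eigenvalue of the inclusion matrix of
lines and `k`-spaces on the second eigenspace, as a multiple of the number of `k`-spaces through
a line. -/
noncomputable def lineEigen (q x z : ℝ) : ℝ :=
  x ^ 2 * (q * z - 1) * (z - 1) / ((q * x * z - 1) * (x * z - 1))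

/-- The coefficient of the degree squares of points in the bound for lines. -/
noncomputable def linePointCoeff (q x z : ℝ) : ℝ :=
  (q * x - 1) * (x - 1) / ((q - 1) * q * (x * z - 1))

/-- The coefficient of the square of the size in the bound for lines. -/
noncomputable def lineConstCoeff (q x z : ℝ) : ℝ :=
  -((q * q * x - 1) * (q * x - 1) ^ 2 * (x - 1) /
    (q * (q ^ 2 - 1) * (q - 1) * (q * x * z - 1) * (x * z - 1)))

section Algebra

variable {q x z : ℝ}

/-- The same mechanism one level higher: with v = r₂ · `lineEigen q x z`, the function f = v·1_F +
β·D₁ - D₂ + γM satisfies ‖f‖² = v⟨1_F, f⟩ for β and γ the coefficients defined above, and v > 0. -/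
theorem lines_degSq_le (hq : 1 < q) (hx : 1 < x) (hz : 1 < z) {r₁ r₂ r₃ r₄ N M Q₁ Q₂ : ℝ}
    (hr₂ : 1 ≤ r₂)
    (hN : r₁ * (q * q * q * x * z - 1) = N * (q * q * x - 1))
    (hr₁ : r₂ * (q * q * x * z - 1) = r₁ * (q * x - 1))
    (hr₃ : r₃ * (q * x * z - 1) = r₂ * (x - 1))
    (hr₄ : r₄ * (x * z - 1) = r₃ * (x / q - 1))
    (h : ∀ a b c d : ℝ, 0 ≤ a ^ 2 * M +
      b ^ 2 * ((r₁ - r₂) * Q₁ + r₂ * ((q * q * x - 1) / (q - 1) * M) ^ 2) +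
      c ^ 2 * ((r₂ - (q + 1) * r₃ + q * r₄) * Q₂ +
        (r₃ - r₄) * (((q * x - 1) / (q - 1)) ^ 2 * Q₁) +
        r₄ * ((q * q * x - 1) * (q * x - 1) / ((q ^ 2 - 1) * (q - 1)) * M) ^ 2) +
      d ^ 2 * N + 2 * a * b * Q₁ + 2 * a * c * Q₂ +
      2 * b * c * ((r₂ - r₃) * ((q * x - 1) / (q - 1) * Q₁) +
        r₃ * (((q * q * x - 1) / (q - 1) * M) *
          ((q * q * x - 1) * (q * x - 1) / ((q ^ 2 - 1) * (q - 1)) * M))) +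
      2 * a * d * M + 2 * b * d * (r₁ * ((q * q * x - 1) / (q - 1) * M)) +
      2 * c * d * (r₂ * ((q * q * x - 1) * (q * x - 1) / ((q ^ 2 - 1) * (q - 1)) * M))) :
    Q₂ ≤ r₂ * lineEigen q x z * M + linePointCoeff q x z * Q₁ + lineConstCoeff q x z * M ^ 2 := by
  have h1 : 0 < q - 1 := by linarith
  have hqx : 1 < q * x := by nlinarith
  have hxz : 1 < x * z := by nlinarith
  have hqqx : 1 < q * q * x := by nlinarith
  have hqxz : 1 < q * x * z := by nlinarith
  have hqqxz : 1 < q * q * x * z := by nlinarith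
  have hqq : 1 < q ^ 2 := by nlinarith
  have p1 : 0 < q * x - 1 := by linarith
  have p2 : 0 < x * z - 1 := by linarith
  have p3 : 0 < q * q * x - 1 := by linarith
  have p4 : 0 < q * x * z - 1 := by linarith
  have p5 : 0 < q ^ 2 - 1 := by linarith
  have p6 : 0 < z - 1 := by linarith
  have p7 : 0 < q * z - 1 := by nlinarith
  have e1 : r₁ = r₂ * (q * q * x * z - 1) / (q * x - 1) := by rw [eq_div_iff p1.ne', hr₁]
  have e3 : r₃ = r₂ * (x - 1) / (q * x * z - 1) := by rw [eq_div_iff p4.ne', hr₃]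
  have e4 : r₄ = r₂ * (x - 1) * (x / q - 1) / ((q * x * z - 1) * (x * z - 1)) := by
    rw [eq_div_iff (by positivity), ← mul_assoc, mul_right_comm, hr₄, mul_right_comm, hr₃]
  have eN : N = r₂ * (q * q * x * z - 1) * (q * q * q * x * z - 1) /
      ((q * x - 1) * (q * q * x - 1)) := by
    rw [eq_div_iff (by positivity), mul_comm (q * x - 1), ← mul_assoc, ← hN, mul_right_comm, ← hr₁]
  have ev : r₂ - (q + 1) * r₃ + q * r₄ = r₂ * lineEigen q x z := by
    rw [e3, e4, lineEigen]
    field_simp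
    ring
  have hv : 0 < r₂ * lineEigen q x z := by
    unfold lineEigen
    positivity
  clear hN hr₁ hr₃ hr₄
  have hA := h (r₂ * lineEigen q x z) (linePointCoeff q x z) (-1) (lineConstCoeff q x z * M)
  rw [ev] at hA
  clear h
  -- `c1` and `c2` compare the coefficients of Q₁ and M² in ‖f‖² = v⟨1_F, f⟩; those of M and Q₂
  -- agree by the choice of a and c.
  have c1 : (r₂ * lineEigen q x z) * linePointCoeff q x z +
      (r₃ - r₄) * ((q * x - 1) / (q - 1)) ^ 2 + linePointCoeff q x z ^ 2 * (r₁ - r₂) -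
      2 * linePointCoeff q x z * (r₂ - r₃) * ((q * x - 1) / (q - 1)) = 0 := by
    have d1 : r₁ - r₂ = r₂ * (q * x * (q * z - 1)) / (q * x - 1) := by
      rw [e1, eq_div_iff p1.ne', sub_mul, div_mul_cancel₀ _ p1.ne']
      ring
    have d2 : r₂ - r₃ = r₂ * (x * (q * z - 1)) / (q * x * z - 1) := by
      rw [e3, eq_div_iff p4.ne', sub_mul, div_mul_cancel₀ _ p4.ne']
      ring
    have d3 : r₃ - r₄ = r₂ * (x - 1) * (x * (q * z - 1)) /
        (q * ((q * x * z - 1) * (x * z - 1))) := by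
      rw [e3, e4]
      field_simp
      ring
    rw [d1, d2, d3, lineEigen, linePointCoeff]
    generalize hB : q * x - 1 = B at *
    generalize hS : q - 1 = S at *
    generalize hD : q * x * z - 1 = D at *
    generalize hE : x * z - 1 = E at *
    field_simp
    rw [← hB, ← hE, ← hD, ← hS]
    ring
  have c2 : (r₂ * lineEigen q x z) * lineConstCoeff q x z +
      r₄ * ((q * q * x - 1) * (q * x - 1) / ((q ^ 2 - 1) * (q - 1))) ^ 2 +
      linePointCoeff q x z ^ 2 * r₂ * ((q * q * x - 1) / (q - 1)) ^ 2 +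
      lineConstCoeff q x z ^ 2 * N -
      2 * linePointCoeff q x z * r₃ * (((q * q * x - 1) / (q - 1)) *
          ((q * q * x - 1) * (q * x - 1) / ((q ^ 2 - 1) * (q - 1)))) -
      2 * lineConstCoeff q x z * r₂ *
        ((q * q * x - 1) * (q * x - 1) / ((q ^ 2 - 1) * (q - 1))) +
      2 * linePointCoeff q x z * lineConstCoeff q x z * r₁ * ((q * q * x - 1) / (q - 1)) = 0 := by
    rw [e3, e4, e1, eN, lineEigen, linePointCoeff, lineConstCoeff]
    generalize hC : q * q * x - 1 = A at *
    generalize hB : q * x - 1 = B at *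
    generalize hW : q ^ 2 - 1 = W at *
    generalize hS : q - 1 = S at *
    generalize hD : q * x * z - 1 = D at *
    generalize hE : x * z - 1 = E at *
    field_simp
    rw [← hC, ← hB, ← hE, ← hD, ← hS, ← hW]
    ring
  have hB : 0 ≤ (r₂ * lineEigen q x z) * (r₂ * lineEigen q x z * M + linePointCoeff q x z * Q₁ +
      lineConstCoeff q x z * M ^ 2 - Q₂) := by
    linear_combination hA + Q₁ * c1 + M ^ 2 * c2
  have := nonneg_of_mul_nonneg_right hB hv
  linarith

end Algebra

/-! ### Inequalities behind the minorant and its diagonal term -/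

section Inequalities

variable {q x z : ℝ}

theorem linePointCoeff_mul_le_one (hq : 2 ≤ q) (hx : q ≤ x) (hz : q * x ≤ z) :
    linePointCoeff q x z * q ≤ 1 := by
  -- Substituting the slacks of q ≥ 2, x ≥ q, z ≥ qx leaves a polynomial in a, b, c without negative
  -- coefficients. The later polynomial inequalities use the same device.
  obtain ⟨a, ha, rfl⟩ : ∃ a, 0 ≤ a ∧ q = 2 + a := ⟨q - 2, by linarith, by ring⟩
  obtain ⟨b, hb, rfl⟩ : ∃ b, 0 ≤ b ∧ x = 2 + a + b := ⟨x - (2 + a), by linarith, by ring⟩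
  obtain ⟨c, hc, rfl⟩ : ∃ c, 0 ≤ c ∧ z = (2 + a) * (2 + a + b) + c :=
    ⟨z - (2 + a) * (2 + a + b), by linarith, by ring⟩
  have h1 : 0 < 2 + a - 1 := by linarith
  have h2 : 0 < (2 + a + b) * ((2 + a) * (2 + a + b) + c) - 1 := by
    ring_nf
    positivity
  have h3 : 0 < 2 + a := by linarith
  unfold linePointCoeff
  rw [div_mul_eq_mul_div, div_le_one (by positivity), ← sub_nonneg]
  ring_nf
  positivity

theorem linePointCoeff_pos (hq : 1 < q) (hx : 1 < x) (hz : 1 < z) :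
    0 < linePointCoeff q x z := by
  have h1 : 0 < q - 1 := by linarith
  have h2 : 0 < q * x - 1 := by nlinarith
  have h3 : 0 < x * z - 1 := by nlinarith
  have h4 : 0 < x - 1 := by linarith
  unfold linePointCoeff
  positivity

theorem lineConstCoeff_nonpos (hq : 1 < q) (hx : 1 < x) (hz : 1 < z) :
    lineConstCoeff q x z ≤ 0 := by
  have h1 : 0 < q - 1 := by linarith
  have h2 : 0 < q * x - 1 := by nlinarith
  have h3 : 0 < x * z - 1 := by nlinarith
  have h4 : 0 < x - 1 := by linarith
  have h5 : 0 < q ^ 2 - 1 := by nlinarith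
  have h6 : 0 < q * q * x - 1 := by nlinarith
  have h7 : 0 < q * x * z - 1 := by nlinarith
  unfold lineConstCoeff
  rw [neg_nonpos]
  positivity

/-- A positive number whose product with `linePointCoeff q x z` bounds `lineGap q x z` from
below. -/
noncomputable def gapFactor (q x z : ℝ) : ℝ := (q * x * (z - q - 1) + 1) / (q ^ 2 - 1)

/-- Minus the value at `d = k - 1` of the quadratic that minorizes the distance up to scaling. -/
noncomputable def lineGap (q x z : ℝ) : ℝ :=
  (q * x - 1) * (x - 1) / ((q ^ 2 - 1) * (q - 1)) -
    linePointCoeff q x z * ((q * x - 1) / (q - 1)) - lineConstCoeff q x z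

theorem gapFactor_pos (hq : 2 ≤ q) (hx : q ≤ x) (hz : q * x ≤ z) : 0 < gapFactor q x z := by
  have h1 : 0 < q ^ 2 - 1 := by nlinarith
  have h2 : 0 < z - q - 1 := by nlinarith
  have h3 : 0 < q := by linarith
  have h4 : 0 < x := by linarith
  unfold gapFactor
  positivity

/-- The first two terms of `lineGap` equal this product exactly; the remaining one is
-`lineConstCoeff` ≥ 0. -/
theorem linePointCoeff_mul_gapFactor_le (hq : 1 < q) (hx : 1 < x) (hz : 1 < z) :
    linePointCoeff q x z * gapFactor q x z ≤ lineGap q x z := by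
  have h := lineConstCoeff_nonpos hq hx hz
  have h1 : q - 1 ≠ 0 := by linarith
  have h3 : x * z - 1 ≠ 0 := by nlinarith
  have h5 : q ^ 2 - 1 ≠ 0 := by nlinarith
  have key : linePointCoeff q x z * gapFactor q x z =
      (q * x - 1) * (x - 1) / ((q ^ 2 - 1) * (q - 1)) -
        linePointCoeff q x z * ((q * x - 1) / (q - 1)) := by
    unfold linePointCoeff gapFactor
    field_simp
    ring
  rw [key]
  unfold lineGap
  linarith

theorem lineGap_pos (hq : 2 ≤ q) (hx : q ≤ x) (hz : q * x ≤ z) : 0 < lineGap q x z := by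
  have hx₁ : 1 < x := by linarith
  have hz₁ : 1 < z := by nlinarith
  exact lt_of_lt_of_le (mul_pos (linePointCoeff_pos (by linarith) hx₁ hz₁)
    (gapFactor_pos hq hx hz)) (linePointCoeff_mul_gapFactor_le (by linarith) hx₁ hz₁)

/-- The amount by which the leading coefficient of the bound for stars exceeds `1`. -/
noncomputable def excess (q x z : ℝ) : ℝ := q * (x - 1) * (z - 1) / ((q - 1) * (q * x * z - 1))

theorem excess_pos (hq : 1 < q) (hx : 1 < x) (hz : 1 < z) : 0 < excess q x z := by
  have h1 : 0 < q - 1 := by linarith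
  have h4 : 0 < x - 1 := by linarith
  have h5 : 0 < z - 1 := by linarith
  have h7 : 0 < q * x * z - 1 := by
    have : 1 < q * x := by nlinarith
    nlinarith
  unfold excess
  positivity

theorem one_add_excess (hq : 1 < q) (hx : 1 ≤ x) (hz : 1 < z) :
    1 + excess q x z = (q * x - 1) * (q * z - 1) / ((q - 1) * (q * x * z - 1)) := by
  have h1 : q - 1 ≠ 0 := by linarith
  have h7 : q * x * z - 1 ≠ 0 := by
    have : 1 < q * x := by nlinarith
    nlinarith
  unfold excess
  field_simp
  ring

theorem excess_le_gapFactor (hq : 2 ≤ q) (hx : q ≤ x) (hz : q * x ≤ z) :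
    excess q x z ≤ (1 - excess q x z) * gapFactor q x z := by
  have h1 : 0 < q - 1 := by linarith
  have h5 : 0 < q ^ 2 - 1 := by nlinarith
  have h7 : 0 < q * x * z - 1 := by
    have : 1 < q * x := by nlinarith
    have : 1 < z := by nlinarith
    nlinarith
  have key : (1 - excess q x z) * gapFactor q x z - excess q x z =
      ((q * (q - 2) * x * z + q * x + q * z - 2 * q + 1) * (q * x * (z - q - 1) + 1) -
        q * (x - 1) * (z - 1) * (q ^ 2 - 1)) / ((q ^ 2 - 1) * ((q - 1) * (q * x * z - 1))) := by
    unfold excess gapFactor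
    field_simp
    ring
  rw [← sub_nonneg, key]
  refine div_nonneg ?_ (by positivity)
  clear key h1 h5 h7
  obtain ⟨a, ha, rfl⟩ : ∃ a, 0 ≤ a ∧ q = 2 + a := ⟨q - 2, by linarith, by ring⟩
  obtain ⟨b, hb, rfl⟩ : ∃ b, 0 ≤ b ∧ x = 2 + a + b := ⟨x - (2 + a), by linarith, by ring⟩
  obtain ⟨c, hc, rfl⟩ : ∃ c, 0 ≤ c ∧ z = (2 + a) * (2 + a + b) + c :=
    ⟨z - (2 + a) * (2 + a + b), by linarith, by ring⟩
  ring_nf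
  positivity

/-- This is what keeps the minorant at most 2 for d ≤ k - 2. -/
theorem excess_div_lineGap_mul_le (hq : 2 ≤ q) (hx : q ≤ x) (hz : q * x ≤ z) :
    excess q x z / lineGap q x z * linePointCoeff q x z ≤ 1 - excess q x z := by
  have hx' : 1 < x := by linarith
  have hz' : 1 < z := by nlinarith
  have hq' : 1 < q := by linarith
  have hT := gapFactor_pos hq hx hz
  have he := linePointCoeff_pos hq' hx' hz'
  have hu := excess_pos hq' hx' hz'
  have h1 := linePointCoeff_mul_gapFactor_le hq' hx' hz'
  have h2 := excess_le_gapFactor hq hx hz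
  have h3 : 0 ≤ 1 - excess q x z := by
    by_contra h
    push Not at h
    nlinarith
  rw [div_mul_eq_mul_div, div_le_iff₀ (lineGap_pos hq hx hz)]
  calc excess q x z * linePointCoeff q x z
      ≤ (1 - excess q x z) * gapFactor q x z * linePointCoeff q x z :=
        mul_le_mul_of_nonneg_right h2 he.le
    _ = (1 - excess q x z) * (linePointCoeff q x z * gapFactor q x z) := by ring
    _ ≤ _ := mul_le_mul_of_nonneg_left h1 h3

/-- The diagonal term for k = 3, where x = q and r = [n-2]_1. The two sides are equal, so no
estimate can be wasted here. -/
theorem diagonal_le_of_three (hq : 1 < q) (hz : 1 < z) {r : ℝ}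
    (hr : r = (q * q * z - 1) / (q - 1)) (hgap : 0 < lineGap q q z) :
    excess q q z / lineGap q q z * (r * lineEigen q q z + lineConstCoeff q q z +
      linePointCoeff q q z * ((q * q * q - 1) / (q - 1)) -
        (q * q * q - 1) * (q * q - 1) / ((q ^ 2 - 1) * (q - 1))) ≤
      (1 + excess q q z) * (r * (q - 1) / (q * q - 1) - 1) := by
  have h1 : q - 1 ≠ 0 := by linarith
  have h2 : q * q - 1 ≠ 0 := by nlinarith
  have h3 : q * q * z - 1 ≠ 0 := by
    have : 1 < q * q := by nlinarith
    nlinarith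
  have h4 : q * z - 1 ≠ 0 := by nlinarith
  have hq0 : q ≠ 0 := by linarith
  refine le_of_eq ?_
  rw [one_add_excess hq hq.le hz, div_mul_eq_mul_div, div_eq_iff hgap.ne', hr]
  unfold lineGap lineEigen lineConstCoeff linePointCoeff excess
  rw [show q ^ 2 - 1 = q * q - 1 by ring]
  generalize hA : q * q - 1 = A at *
  generalize hS : q - 1 = S at *
  generalize hD : q * q * z - 1 = D at *
  generalize hE : q * z - 1 = E at *
  field_simp
  rw [← hA, ← hS, ← hD, ← hE]
  ring

/-- For k ≥ 4 the ratio R = r(q-1)/(qx-1) is at least 4, so R - 1 ≥ 3R/4. After the nonpositive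
terms without r are dropped, both sides are proportional to r, and the loss of the factor 3/4 is
affordable. -/
theorem diagonal_le_of_large (hq : 2 ≤ q) (hx : q * q ≤ x) (hz : q * x ≤ z) {r : ℝ}
    (hr : 4 * (q * x - 1) ≤ r * (q - 1)) :
    excess q x z / lineGap q x z * (r * lineEigen q x z + lineConstCoeff q x z +
      linePointCoeff q x z * ((q * q * x - 1) / (q - 1)) -
        (q * q * x - 1) * (q * x - 1) / ((q ^ 2 - 1) * (q - 1))) ≤
      (1 + excess q x z) * (r * (q - 1) / (q * x - 1) - 1) := by
  have hxq : q ≤ x := by nlinarith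
  have hx' : 1 < x := by linarith
  have hz' : 1 < z := by nlinarith
  have hq' : 1 < q := by linarith
  have hq0 : 0 < q := by linarith
  have p1 : 0 < q - 1 := by linarith
  have p2 : 0 < q * x - 1 := by nlinarith
  have p3 : 0 < q * x * z - 1 := by nlinarith
  have p4 : 0 < x * z - 1 := by nlinarith
  have p5 : 0 < q ^ 2 - 1 := by nlinarith
  have p6 : 0 < q * q * x - 1 := by nlinarith
  have p7 : 0 < q * z - 1 := by nlinarith
  have p8 : 0 < z - 1 := by linarith
  have p9 : 0 < x - 1 := by linarith
  have hr0 : 0 < r := by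
    by_contra h
    push Not at h
    nlinarith
  have hT := gapFactor_pos hq hxq hz
  have he := linePointCoeff_pos hq' hx' hz'
  have hu := excess_pos hq' hx' hz'
  have hg := lineGap_pos hq hxq hz
  have h1 := linePointCoeff_mul_gapFactor_le hq' hx' hz'
  have hv : 0 < lineEigen q x z := by
    unfold lineEigen
    positivity
  have h2 : lineConstCoeff q x z + linePointCoeff q x z * ((q * q * x - 1) / (q - 1)) -
        (q * q * x - 1) * (q * x - 1) / ((q ^ 2 - 1) * (q - 1)) ≤ 0 := by
    have h3 := lineConstCoeff_nonpos hq' hx' hz'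
    -- Multiplied by [k]_1, the right side becomes [k]_2; the left is at most 1, the right at least
    -- 1.
    have h4 : linePointCoeff q x z ≤ (q * x - 1) / (q ^ 2 - 1) := by
      have h5 : linePointCoeff q x z ≤ 1 := by
        have := linePointCoeff_mul_le_one hq hxq hz
        nlinarith
      refine h5.trans ?_
      rw [one_le_div p5]
      nlinarith
    have h6 := mul_le_mul_of_nonneg_right h4 (div_pos p6 p1).le
    have h7 : (q * x - 1) / (q ^ 2 - 1) * ((q * q * x - 1) / (q - 1)) =
        (q * q * x - 1) * (q * x - 1) / ((q ^ 2 - 1) * (q - 1)) := by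
      rw [div_mul_div_comm, mul_comm (q * x - 1)]
    linarith
  have h3 : excess q x z / lineGap q x z ≤
      excess q x z / (linePointCoeff q x z * gapFactor q x z) :=
    div_le_div_of_nonneg_left hu.le (mul_pos he hT) h1
  have h4 : 3 * (q * x * z - 1) * (q * x - 1) * (q * x * (z - q - 1) + 1) -
      4 * (q ^ 2 * x ^ 2 * (z - 1) ^ 2 * (q ^ 2 - 1)) ≥ 0 := by
    clear * - hq hx hz
    obtain ⟨a, ha, rfl⟩ : ∃ a, 0 ≤ a ∧ q = 2 + a := ⟨q - 2, by linarith, by ring⟩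
    obtain ⟨b, hb, rfl⟩ : ∃ b, 0 ≤ b ∧ x = (2 + a) * (2 + a) + b :=
      ⟨x - (2 + a) * (2 + a), by linarith, by ring⟩
    obtain ⟨c, hc, rfl⟩ : ∃ c, 0 ≤ c ∧ z = (2 + a) * ((2 + a) * (2 + a) + b) + c :=
      ⟨z - (2 + a) * ((2 + a) * (2 + a) + b), by linarith, by ring⟩
    rw [ge_iff_le]
    ring_nf
    positivity
  have hT' : gapFactor q x z * (q ^ 2 - 1) = q * x * (z - q - 1) + 1 := by
    unfold gapFactor
    rw [div_mul_cancel₀ _ p5.ne']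
  have h5 : 4 * (q ^ 2 * x ^ 2 * (z - 1) ^ 2) ≤
      3 * (q * x * z - 1) * (q * x - 1) * gapFactor q x z := by
    rw [← hT'] at h4
    refine le_of_mul_le_mul_right ?_ p5
    linarith
  calc _ ≤ excess q x z / lineGap q x z * (r * lineEigen q x z) := by
        refine mul_le_mul_of_nonneg_left ?_ (div_pos hu hg).le
        linarith
    _ ≤ excess q x z / (linePointCoeff q x z * gapFactor q x z) * (r * lineEigen q x z) :=
        mul_le_mul_of_nonneg_right h3 (by positivity)
    _ = 4 * (q ^ 2 * x ^ 2 * (z - 1) ^ 2) *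
          (r * (q * z - 1) / (4 * (q * x * z - 1) ^ 2 * (q * x - 1) * gapFactor q x z)) := by
        unfold excess linePointCoeff lineEigen
        field_simp
    _ ≤ 3 * (q * x * z - 1) * (q * x - 1) * gapFactor q x z *
          (r * (q * z - 1) / (4 * (q * x * z - 1) ^ 2 * (q * x - 1) * gapFactor q x z)) :=
        mul_le_mul_of_nonneg_right h5 (by positivity)
    _ = (q * x - 1) * (q * z - 1) / ((q - 1) * (q * x * z - 1)) *
          (3 / 4 * (r * (q - 1) / (q * x - 1))) := by
        field_simp
    _ ≤ _ := by
        rw [one_add_excess hq' hx'.le hz']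
        refine mul_le_mul_of_nonneg_left ?_ (by positivity)
        have : 4 ≤ r * (q - 1) / (q * x - 1) := by rwa [le_div_iff₀ p2]
        linarith

/-- Rewrites the stated second bound in the shape produced by a minorant with leading value 1 +
`excess q x z`. The value x = 1 is allowed, so that k = 2 is covered. -/
theorem lines_bound_eq (hq : 1 < q) (hx : 1 ≤ x) (hz : 1 < z) {N r₁ r₂ M k : ℝ} (hM : 0 < M)
    (hN : r₁ * (q * q * q * x * z - 1) = N * (q * q * x - 1))
    (hr₁ : r₂ * (q * q * x * z - 1) = r₁ * (q * x - 1)) :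
    (N / M - (q * q * q * x * z - 1) * (q * q * x * z - 1) / ((q - 1) * (q * q * x - 1))) *
        (M ^ 2 * (q * q * x - 1) * (q * x - 1) * (q * z - 1) /
          ((q * q * q * x * z - 1) * (q * q * x * z - 1) * (q * x * z - 1))) + k * M ^ 2 =
      k * M ^ 2 - (1 + excess q x z) * M ^ 2 +
        (1 + excess q x z) * (r₂ * (q - 1) / (q * x - 1)) * M := by
  have h1 : 0 < q - 1 := by linarith
  have hqx : 1 < q * x := by nlinarith
  have hqqx : 1 < q * q * x := by nlinarith
  have hqxz : 1 < q * x * z := by nlinarith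
  have hqqxz : 1 < q * q * x * z := by nlinarith
  have hqqqxz : 1 < q * q * q * x * z := by nlinarith
  have p1 : 0 < q * x - 1 := by linarith
  have p3 : 0 < q * q * x - 1 := by linarith
  have p4 : 0 < q * x * z - 1 := by linarith
  have p5 : 0 < q * q * x * z - 1 := by linarith
  have p6 : 0 < q * q * q * x * z - 1 := by linarith
  have eN : N = r₂ * (q * q * x * z - 1) * (q * q * q * x * z - 1) /
      ((q * x - 1) * (q * q * x - 1)) := by
    rw [eq_div_iff (by positivity), mul_comm (q * x - 1), ← mul_assoc, ← hN, mul_right_comm, ← hr₁]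
  rw [one_add_excess hq hx hz, eN]
  clear hN hr₁ eN
  generalize q * x - 1 = A at *
  generalize q * q * x - 1 = B at *
  generalize q * x * z - 1 = C at *
  generalize q * q * x * z - 1 = D at *
  generalize q * q * q * x * z - 1 = E at *
  generalize q - 1 = S at *
  field_simp
  ring

end Inequalities

theorem one_le_upCount {q n k j : ℕ} (hq : 1 < q) (hkn : k ≤ n) (hj : j ≤ k) :
    1 ≤ upCount q n k j := by
  unfold upCount
  rw [if_pos hj]
  exact one_le_gaussBinom hq (by omega)

/-- The quadratic in `[d]` used as a minorant of the distance `k - d`. -/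
theorem minorant_le {q x z : ℝ} (hq : 2 ≤ q) (hx : q ≤ x) (hz : q * x ≤ z) {Q j d : ℕ}
    (hQ : (Q : ℝ) = q) (hj : x = q ^ j) (hd : d < j + 2) :
    1 + excess q x z + excess q x z / lineGap q x z * lineConstCoeff q x z +
      excess q x z / lineGap q x z * linePointCoeff q x z * gaussBinom Q d 1 -
      excess q x z / lineGap q x z * gaussBinom Q d 2 ≤ ((j + 2 : ℕ) : ℝ) - d := by
  have hx' : 1 < x := by linarith
  have hz' : 1 < z := by nlinarith
  have hq' : 1 < q := by linarith
  have p1 : 0 < q - 1 := by linarith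
  have p5 : 0 < q ^ 2 - 1 := by nlinarith
  have hg := lineGap_pos hq hx hz
  have hu := excess_pos hq' hx' hz'
  rw [gaussBinom_one_right, gaussBinom_two_right, hQ]
  obtain hd' | hd' : d = j + 1 ∨ d ≤ j := by omega
  -- At d = k - 1 the bracket equals -`lineGap`, so the scaling by excess/gap makes the minorant
  -- exactly 1.
  · subst hd'
    have e1 : q ^ (j + 1) = q * x := by rw [hj, pow_succ']
    rw [Nat.add_sub_cancel, e1, ← hj]
    have : 1 + excess q x z + excess q x z / lineGap q x z * lineConstCoeff q x z +
      excess q x z / lineGap q x z * linePointCoeff q x z * ((q * x - 1) / (q - 1)) -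
      excess q x z / lineGap q x z * ((q * x - 1) * (x - 1) / ((q ^ 2 - 1) * (q - 1))) =
      1 + excess q x z - excess q x z / lineGap q x z * lineGap q x z := by
      conv_rhs => rw [lineGap.eq_1 q x z]
      unfold lineGap
      ring
    rw [this, div_mul_cancel₀ _ hg.ne']
    push_cast
    linarith
  -- With e the point coefficient, e[d]_1 = eq[d-1]_1 + e ≤ [d-1]_1 + e because eq ≤ 1, and [d-1]_1
  -- ≤ [d]_2 for d ≥ 2.
  · have h1 : linePointCoeff q x z * ((q ^ d - 1) / (q - 1)) -
        (q ^ d - 1) * (q ^ (d - 1) - 1) / ((q ^ 2 - 1) * (q - 1)) ≤ linePointCoeff q x z := by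
      have he := linePointCoeff_pos hq' hx' hz'
      have heq := linePointCoeff_mul_le_one hq hx hz
      obtain rfl | rfl | ⟨i, rfl⟩ : d = 0 ∨ d = 1 ∨ ∃ i, d = i + 2 := by
        rcases d with _ | _ | i
        · exact Or.inl rfl
        · exact Or.inr (Or.inl rfl)
        · exact Or.inr (Or.inr ⟨i, rfl⟩)
      · simp [he.le]
      · simp [p1.ne']
      · rw [show i + 2 - 1 = i + 1 by omega]
        have hw : 1 ≤ q ^ i := one_le_pow₀ hq'.le
        have e1 : q ^ (i + 1) = q * q ^ i := pow_succ' _ _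
        have e2 : q ^ (i + 2) = q ^ 2 * q ^ i := by rw [pow_add, mul_comm]
        rw [e1, e2]
        set w := q ^ i
        have h2 : 0 < q * w - 1 := by nlinarith
        have h3 : linePointCoeff q x z * ((q ^ 2 * w - 1) / (q - 1)) =
            linePointCoeff q x z * q * ((q * w - 1) / (q - 1)) + linePointCoeff q x z := by
          field_simp
          ring
        have h4 : linePointCoeff q x z * q * ((q * w - 1) / (q - 1)) ≤
            1 * ((q * w - 1) / (q - 1)) :=
          mul_le_mul_of_nonneg_right heq (by positivity)
        have h5 : 1 * ((q * w - 1) / (q - 1)) ≤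
            (q ^ 2 * w - 1) / (q ^ 2 - 1) * ((q * w - 1) / (q - 1)) := by
          refine mul_le_mul_of_nonneg_right ?_ (by positivity)
          rw [one_le_div p5]
          nlinarith
        have h6 : (q ^ 2 * w - 1) / (q ^ 2 - 1) * ((q * w - 1) / (q - 1)) =
            (q ^ 2 * w - 1) * (q * w - 1) / ((q ^ 2 - 1) * (q - 1)) := div_mul_div_comm _ _ _ _
        linarith
    have h2 := excess_div_lineGap_mul_le hq hx hz
    have h3 := lineConstCoeff_nonpos hq' hx' hz'
    have h4 : (2 : ℝ) ≤ ((j + 2 : ℕ) : ℝ) - d := by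
      have : (d : ℝ) ≤ j := by exact_mod_cast hd'
      push_cast
      linarith
    have hc : 0 ≤ excess q x z / lineGap q x z := (div_pos hu hg).le
    have h5 := mul_le_mul_of_nonneg_left h1 hc
    have h6 := mul_nonpos_of_nonneg_of_nonpos hc h3
    refine le_trans ?_ h4
    linarith

/-- Climbing down from r₄ ≥ 1, available once k ≥ 4: r₃ ≥ z ≥ 4, then r₂ ≥ r₃qz ≥ 4qx. -/
theorem four_mul_le_of_ratios {q x z r₂ r₃ r₄ : ℝ} (hq : 2 ≤ q) (hx : q * q ≤ x)
    (hz : q * x ≤ z) (hr₄ : 1 ≤ r₄) (h₃ : r₃ * (q * x * z - 1) = r₂ * (x - 1))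
    (h₄ : r₄ * (x * z - 1) = r₃ * (x / q - 1)) : 4 * (q * x - 1) ≤ r₂ * (q - 1) := by
  have hq0 : 0 < q := by linarith
  have hx0 : 4 ≤ x := by nlinarith
  have hxz : 2 * x ≤ z := (mul_le_mul_of_nonneg_right hq (by linarith)).trans hz
  have hy : 1 < x / q := by
    rw [one_lt_div hq0]
    nlinarith
  have hyx : x / q ≤ x := div_le_self (by linarith) (by linarith)
  have h5 : z ≤ r₃ := by
    refine le_of_mul_le_mul_right (a := x / q - 1) ?_ (by linarith)
    rw [← h₄]
    have h6 : 0 ≤ (r₄ - 1) * (x * z - 1) := mul_nonneg (by linarith) (by nlinarith)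
    have h7 : z * (x / q) ≤ z * x := mul_le_mul_of_nonneg_left hyx (by linarith)
    linarith
  have h6 : r₃ * (q * z) ≤ r₂ := by
    refine le_of_mul_le_mul_right (a := x - 1) ?_ (by linarith)
    rw [← h₃]
    have : 0 ≤ r₃ * (q * z - 1) := mul_nonneg (by linarith) (by nlinarith)
    linarith
  have h9 : 4 * (q * z) ≤ r₃ * (q * z) :=
    mul_le_mul_of_nonneg_right (by linarith) (mul_nonneg hq0.le (by linarith))
  have h10 : q * x ≤ q * z := mul_le_mul_of_nonneg_left (by linarith) hq0.le
  have h11 : 0 ≤ r₂ := by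
    have : 0 ≤ q * x := mul_nonneg hq0.le (by linarith)
    linarith
  have h12 : r₂ * 1 ≤ r₂ * (q - 1) := mul_le_mul_of_nonneg_left (by linarith) h11
  linarith

/-! ### The second inequality and the conclusion -/

section Main

variable {K V : Type*} [Field K] [Finite K] [AddCommGroup V] [Module K V] [FiniteDimensional K V]

theorem totalInt_le_lines {j l : ℕ} (F : Finset (Grass K V (j + 2))) {q : ℕ}
    (hq : Nat.card K = q) (hn : finrank K V = j + 2 + (l + 1)) (hj : 1 ≤ j) (hl : j + 1 ≤ l) :
    (totalInt F : ℝ) ≤ ((j + 2 : ℕ) : ℝ) * (F.card : ℝ) ^ 2 -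
      (1 + excess q (q ^ j) (q ^ l)) * (F.card : ℝ) ^ 2 +
      (1 + excess q (q ^ j) (q ^ l)) *
        (upCount q (j + 2 + (l + 1)) (j + 2) 2 * ((q : ℝ) - 1) / ((q : ℝ) * q ^ j - 1)) *
        F.card := by
  have hq1 : 1 < q := by rw [← hq]; exact Finite.one_lt_card
  have hq2 : (2 : ℝ) ≤ q := by exact_mod_cast hq1
  have hq' : (1 : ℝ) < q := by linarith
  have hkn : j + 2 ≤ j + 2 + (l + 1) := by omega
  have hr0 := upCount_succ_mul hq1 hkn 0
  have hr1 := upCount_succ_mul hq1 hkn 1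
  have hr2 := upCount_succ_mul hq1 hkn 2
  have hr3 := upCount_succ_mul hq1 hkn 3
  have hone := one_le_upCount hq1 hkn (j := 2) (by omega)
  have hA := fun a b c d => sum_sq_degBelow_nonneg F hq hn a b c d
  have e1 : (q : ℝ) ^ (j + 1) = q * q ^ j := pow_succ' _ _
  have e2 : (q : ℝ) ^ (j + 2) = q * q * q ^ j := by ring
  have e3 : (q : ℝ) ^ (j + 2 + (l + 1)) = q * q * q * q ^ j * q ^ l := by ring
  have e4 : (q : ℝ) ^ (j + 1 + (l + 1)) = q * q * q ^ j * q ^ l := by ring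
  have e5 : (q : ℝ) ^ (j + (l + 1)) = q * q ^ j * q ^ l := by ring
  have e6 : (q : ℝ) ^ (j + l) = q ^ j * q ^ l := pow_add _ _ _
  have e7 : (q : ℝ) ^ (j - 1) = q ^ j / q := by
    rw [eq_div_iff (by positivity), ← pow_succ]
    congr 1
    omega
  have hx : (q : ℝ) ≤ q ^ j := le_self_pow₀ hq'.le (by omega)
  have hz : (q : ℝ) * q ^ j ≤ q ^ l := by
    rw [← e1]
    exact pow_le_pow_right₀ hq'.le hl
  have hx' : (1 : ℝ) < q ^ j := by linarith
  have hz' : (1 : ℝ) < q ^ l := one_lt_pow₀ hq' (by omega)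
  rw [upCount_zero, Nat.sub_zero, Nat.sub_zero, e2, e3] at hr0
  rw [show j + 2 + (l + 1) - 1 = j + 1 + (l + 1) by omega, show j + 2 - 1 = j + 1 by omega,
    e1, e4] at hr1
  rw [show j + 2 + (l + 1) - 2 = j + (l + 1) by omega, show j + 2 - 2 = j by omega, e5] at hr2
  rw [show j + 2 + (l + 1) - 3 = j + l by omega, show j + 2 - 3 = j - 1 by omega, e6, e7] at hr3
  have hdeg := lines_degSq_le hq' hx' hz' (M := F.card) (Q₁ := degSq F 1) (Q₂ := degSq F 2)
    hone hr0 hr1 hr2 hr3 (by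
      intro a b c d
      have := hA a b c d
      rw [gaussBinom_one_right, gaussBinom_one_right, gaussBinom_two_right,
        show j + 2 - 1 = j + 1 by omega, e1, e2] at this
      exact this)
  have hg := lineGap_pos hq2 hx hz
  have hu := excess_pos hq' hx' hz'
  have hcert := totalInt_le_of_minorant F hq
    (1 + excess q (q ^ j) (q ^ l) +
      excess q (q ^ j) (q ^ l) / lineGap q (q ^ j) (q ^ l) * lineConstCoeff q (q ^ j) (q ^ l))
    (excess q (q ^ j) (q ^ l) / lineGap q (q ^ j) (q ^ l) * linePointCoeff q (q ^ j) (q ^ l))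
    (excess q (q ^ j) (q ^ l) / lineGap q (q ^ j) (q ^ l))
    (excess q (q ^ j) (q ^ l) / lineGap q (q ^ j) (q ^ l) *
      (upCount q (j + 2 + (l + 1)) (j + 2) 2 * lineEigen q (q ^ j) (q ^ l)))
    (excess q (q ^ j) (q ^ l) / lineGap q (q ^ j) (q ^ l) * lineConstCoeff q (q ^ j) (q ^ l))
    (fun d hd => minorant_le hq2 hx hz rfl rfl hd) (by
      have := mul_le_mul_of_nonneg_left hdeg (div_pos hu hg).le
      linarith)
  -- The coefficient of M from the certificate is s + g(k); after removing 1 + excess from both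
  -- sides, this is the comparison still needed.
  have hdiag : excess q (q ^ j) (q ^ l) / lineGap q (q ^ j) (q ^ l) *
      (upCount q (j + 2 + (l + 1)) (j + 2) 2 * lineEigen q (q ^ j) (q ^ l) +
        lineConstCoeff q (q ^ j) (q ^ l) +
        linePointCoeff q (q ^ j) (q ^ l) * (((q : ℝ) * q * q ^ j - 1) / (q - 1)) -
        ((q : ℝ) * q * q ^ j - 1) * (q * q ^ j - 1) / (((q : ℝ) ^ 2 - 1) * (q - 1))) ≤
      (1 + excess q (q ^ j) (q ^ l)) *
        (upCount q (j + 2 + (l + 1)) (j + 2) 2 * ((q : ℝ) - 1) / (q * q ^ j - 1) - 1) := by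
    obtain rfl | hj2 : j = 1 ∨ 2 ≤ j := by omega
    · rw [pow_one] at hg ⊢
      refine diagonal_le_of_three hq' hz' ?_ hg
      unfold upCount
      rw [if_pos (by omega), show 1 + 2 - 2 = 1 by omega, gaussBinom_one_right,
        show 1 + 2 + (l + 1) - 2 = 1 + (l + 1) by omega, e5, pow_one]
    · have hxx : (q : ℝ) * q ≤ q ^ j := by
        rw [← sq]
        exact pow_le_pow_right₀ hq'.le hj2
      refine diagonal_le_of_large hq2 hxx hz ?_
      have h4 := one_le_upCount hq1 hkn (j := 4) (by omega)
      exact four_mul_le_of_ratios hq2 hxx hz (one_le_upCount hq1 hkn (j := 4) (by omega)) hr2 hr3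
  refine hcert.trans ?_
  rw [gaussBinom_one_right, gaussBinom_two_right, show j + 2 - 1 = j + 1 by omega, e1, e2]
  have := mul_le_mul_of_nonneg_right hdiag (Nat.cast_nonneg (α := ℝ) F.card)
  linarith

theorem totalInt_le_stars {k : ℕ} (F : Finset (Grass K V k)) {q n : ℕ} (hq : Nat.card K = q)
    (hn : finrank K V = n) (hk : 1 ≤ k) (hkn : 2 * k ≤ n) (hF : 1 ≤ F.card) :
    (totalInt F : ℝ) ≤
        (gaussBinom q n k / F.card -
            ((q : ℝ) ^ n - 1) * ((q : ℝ) ^ (n - 1) - 1) / (((q : ℝ) - 1) * ((q : ℝ) ^ k - 1))) *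
          ((F.card : ℝ) ^ 2 * ((q : ℝ) ^ k - 1) * ((q : ℝ) ^ (k - 1) - 1) *
              ((q : ℝ) ^ (n - k) - 1) /
            (((q : ℝ) ^ n - 1) * ((q : ℝ) ^ (n - 1) - 1) * ((q : ℝ) ^ (n - 2) - 1))) +
          k * (F.card : ℝ) ^ 2 := by
  obtain rfl | hk2 := hk.eq_or_lt
  -- For k = 1 the factor q^(k-1) - 1 is zero, also in the 0/0 case n = 2.
  · simpa using totalInt_le_mul_card_sq F
  have hq1 : 1 < q := by rw [← hq]; exact Finite.one_lt_card
  have hq' : (1 : ℝ) < q := by exact_mod_cast hq1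
  have hM : (0 : ℝ) < F.card := by exact_mod_cast hF
  obtain ⟨j, rfl⟩ : ∃ j, k = j + 2 := ⟨k - 2, by omega⟩
  obtain ⟨l, rfl⟩ : ∃ l, n = j + 2 + (l + 1) := ⟨n - j - 3, by omega⟩
  have hkn' : j + 2 ≤ j + 2 + (l + 1) := by omega
  have hr0 := upCount_succ_mul hq1 hkn' 0
  have hr1 := upCount_succ_mul hq1 hkn' 1
  have e1 : (q : ℝ) ^ (j + 1) = q * q ^ j := pow_succ' _ _
  have e2 : (q : ℝ) ^ (j + 2) = q * q * q ^ j := by ring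
  have e3 : (q : ℝ) ^ (j + 2 + (l + 1)) = q * q * q * q ^ j * q ^ l := by ring
  have e4 : (q : ℝ) ^ (j + 1 + (l + 1)) = q * q * q ^ j * q ^ l := by ring
  have e5 : (q : ℝ) ^ (j + (l + 1)) = q * q ^ j * q ^ l := by ring
  have e6 : (q : ℝ) ^ (l + 1) = q * q ^ l := pow_succ' _ _
  have hx' : (1 : ℝ) ≤ q ^ j := one_le_pow₀ hq'.le
  have hz' : (1 : ℝ) < q ^ l := one_lt_pow₀ hq' (by omega)
  rw [upCount_zero, Nat.sub_zero, Nat.sub_zero, e2, e3] at hr0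
  rw [show j + 2 + (l + 1) - 1 = j + 1 + (l + 1) by omega, show j + 2 - 1 = j + 1 by omega,
    e1, e4] at hr1
  rw [show j + 2 + (l + 1) - 1 = j + 1 + (l + 1) by omega, show j + 2 - 1 = j + 1 by omega,
    show j + 2 + (l + 1) - 2 = j + (l + 1) by omega,
    show j + 2 + (l + 1) - (j + 2) = l + 1 by omega, e1, e2, e3, e4, e5, e6,
    lines_bound_eq hq' hx' hz' hM hr0 hr1]
  -- For k = 2 one has x = 1 and zero excess, so the bound only says that distinct members are at
  -- distance at least 1.
  obtain rfl | hj := Nat.eq_zero_or_pos j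
  · have h1 : upCount q (0 + 2 + (l + 1)) (0 + 2) 2 = 1 := by
      simp [upCount, gaussBinom_zero_right]
    have h2 : excess (q : ℝ) (q ^ 0) (q ^ l) = 0 := by simp [excess]
    have h3 : (q : ℝ) - 1 ≠ 0 := by linarith
    refine (totalInt_le_of_one_le F).trans_eq ?_
    rw [h2]
    simp only [zero_add, one_add_one_eq_two, pow_zero, mul_one] at h1 ⊢
    rw [h1, one_mul, div_self h3]
    ring
  · exact totalInt_le_lines F hq hn hj (by omega)

end Main

theorem mainTheorem3 {K V : Type*} [Field K] [Finite K] [AddCommGroup V] [Module K V]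
    [FiniteDimensional K V] (q n k M : ℕ) (hq : Nat.card K = q) (hn : Module.finrank K V = n)
    (hk : 1 ≤ k) (hkn : k ≤ n) (hM : 1 ≤ M)
    (F : Finset (Grass K V k)) (hF : F.card = M) :
    (maxTotalInt F : ℝ) ≤
        (gaussBinom q n k / M - gaussBinom q n 1) *
          (q * (M : ℝ) ^ 2 * gaussBinom q k 1 * gaussBinom q (n - k) 1 /
            (gaussBinom q n 1 * (gaussBinom q n 1 - 1))) + k * (M : ℝ) ^ 2 ∧
    (2 * k ≤ n → (M : ℝ) ≤ gaussBinom q (n - 1) (k - 1) →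
      (maxTotalInt F : ℝ) ≤
        (gaussBinom q n k / M -
            ((q : ℝ) ^ n - 1) * ((q : ℝ) ^ (n - 1) - 1) / (((q : ℝ) - 1) * ((q : ℝ) ^ k - 1))) *
          ((M : ℝ) ^ 2 * ((q : ℝ) ^ k - 1) * ((q : ℝ) ^ (k - 1) - 1) * ((q : ℝ) ^ (n - k) - 1) /
            (((q : ℝ) ^ n - 1) * ((q : ℝ) ^ (n - 1) - 1) * ((q : ℝ) ^ (n - 2) - 1))) +
          k * (M : ℝ) ^ 2) := by
  obtain ⟨G, hG, hmax⟩ := (isGreatest_maxTotalInt F).1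
  rw [hF] at hG
  subst hG
  rw [← hmax]
  exact ⟨totalInt_le_points G hq hn hk hkn hM,
    fun h2k _ => totalInt_le_stars G hq hn hk h2k hM⟩
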